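/- Let $q$ be a prime power, let $n\ge 2$ and $r$ be integers with $\gcd(n,r)=1$ and $\lceil n/2\rceil\le r\le n-1$, and assume that $q$ is odd if $n=2$. Put $T_n(z)=z+z^q+\dots+z^{q^{n-1}}$, let $f_r(x)\in\mathbb F_{q^n}[x]$ be the remainder of $T_n(x^{1+q^r})$ on division by $x^{q^n}-x$, and let $\mathcal X_{n,r}$ be the plane curve $T_n(y)=f_r(x)$ over $\mathbb F_{q^n}$. Then $T_n(y)-f_r(x)$ is irreducible over $\mathbb F_{q^n}$, and exactly one place $P_\infty$ of the function field $F=\mathbb F_{q^n}(x,y)$ of $\mathcal X_{n,r}$ (equivalently, one closed point of the nonsingular projective model) lies over the point $(0:1:0)$ of the projective closure. Its Weierstrass semigroup $H(P_\infty)=\{m\in\mathbb N_0 : \exists f\in F\setminus\{0\},\ \mathrm{div}_\infty(f)=mP_\infty\}$ is $$H(P_\infty)=\langle q^{n-1},\ q^{n-1}+q^{r-1},\ q^n+q^{n-r},\ q^{2r-1}+q^{n-r-1},\ q^{2r}-q^n+q^r+1\rangle .$$ Moreover, $H(P_\infty)$ is telescopic, i.e. it is generated by some sequence $(a_1,\dots,a_m)$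 of positive integers with $\gcd(a_1,\dots,a_m)=1$ such that, with $d_i=\gcd(a_1,\dots,a_i)$, the integer $a_i/d_i$ lies in the semigroup generated by $a_1/d_{i-1},\dots,a_{i-1}/d_{i-1}$ for $i=2,\dots,m$. In particular it is symmetric, i.e. the set $\mathbb N_0\setminus H(P_\infty)$ is finite and, if $g$ is its number of elements, its largest element is $2g-1$. -/

import Mathlib

open Polynomial
open scoped WithZero

noncomputable section

namespace Xnr

/-- The polynomial `T_n = X + X^q + ⋯ + X^(q^(n-1))` over a commutative ring `R`. -/
def tracePoly (R : Type*) [CommRing R] (q n : ℕ) : R[X] :=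
  ∑ i ∈ Finset.range n, X ^ q ^ i

/-- The polynomial `f_r = T_n(x^(1+q^r)) mod (x^(q^n) - x)`. -/
def fPoly (K : Type*) [Field K] (q n r : ℕ) : K[X] :=
  (tracePoly K q n).comp (X ^ (1 + q ^ r)) % (X ^ q ^ n - X)

/-- The polynomial `T_n(y) - f_r(x)`, an element of `K[x][y]`. -/
def curvePoly (K : Type*) [Field K] (q n r : ℕ) : K[X][X] :=
  tracePoly K[X] q n - C (fPoly K q n r)

/-- The affine coordinate ring `K[x, y] / (T_n(y) - f_r(x))`. -/
abbrev CoordinateRing (K : Type*) [Field K] (q n r : ℕ) : Type _ :=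
  AdjoinRoot (curvePoly K q n r)

/-- The function field `K(x, y)`: the fraction ring of the coordinate ring
(a field as soon as the coordinate ring is a domain). -/
abbrev FunctionField (K : Type*) [Field K] (q n r : ℕ) : Type _ :=
  FractionRing (CoordinateRing K q n r)

/-- The coordinate function `x`. -/
def xFun (K : Type*) [Field K] (q n r : ℕ) : FunctionField K q n r :=
  algebraMap (CoordinateRing K q n r) _ (AdjoinRoot.of (curvePoly K q n r) X)

/-- The coordinate function `y`. -/
def yFun (K : Type*) [Field K] (q n r : ℕ) : FunctionField K q n r :=
  algebraMap (CoordinateRing K q n r) _ (AdjoinRoot.root (curvePoly K q n r))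

/-- A place of `F / K`, i.e. a point of the nonsingular projective model, given by its normalized
discrete valuation, which is trivial on `K`. It is written multiplicatively: `v f = exp (-ord f)`. -/
@[ext]
structure Place (K F : Type*) [Field K] [Field F] [Algebra K F] where
  v : Valuation F ℤᵐ⁰
  trivial_on_const : ∀ a : K, a ≠ 0 → v (algebraMap K F a) = 1
  normalized : Function.Surjective v

namespace Place

variable {K F : Type*} [Field K] [Field F] [Algebra K F]

/-- The order `v_P(f)` of a function `f ≠ 0` at the place `P`. -/
def ord (P : Place K F) (f : F) : ℤ := -WithZero.log (P.v f)

/-- The coefficient of `P` in the pole divisor of `f ≠ 0`, namely `max (-v_P(f)) 0`. -/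
def poleOrder (P : Place K F) (f : F) : ℕ := (-P.ord f).toNat

/-- `H(P)`: the `m` for which some function `f ≠ 0` has pole divisor `m P`. -/
def weierstrassSemigroup (P : Place K F) : Set ℕ :=
  {m | ∃ f : F, f ≠ 0 ∧ P.poleOrder f = m ∧ ∀ Q : Place K F, Q ≠ P → Q.poleOrder f = 0}

end Place

/-- The place `P` lies over the point `(0 : 1 : 0)` of the projective closure of the plane curve:
the local coordinates `x / y` and `1 / y` at `(0 : 1 : 0)` vanish at `P`. -/
def LiesOverInfty (K : Type*) [Field K] (q n r : ℕ) [IsDomain (CoordinateRing K q n r)]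
    (P : Place K (FunctionField K q n r)) : Prop :=
  P.v (xFun K q n r) < P.v (yFun K q n r) ∧ 1 < P.v (yFun K q n r)

/-- `d_i = gcd(a_1, …, a_i)` (with indices starting from `0`). -/
def prefixGcd {m : ℕ} (a : Fin m → ℕ) (i : Fin m) : ℕ := (Finset.Iic i).gcd a

/-- Telescopic sequences of positive integers: the gcd is `1`, and for every `j` that has a
predecessor `i`, `a_j / d_j` lies in the semigroup generated by the `a_k / d_i`, `k ≤ i`. -/
structure IsTelescopicSeq {m : ℕ} (a : Fin m → ℕ) : Prop where
  pos : ∀ i, 0 < a i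
  gcd_eq_one : Finset.univ.gcd a = 1
  mem : ∀ i j : Fin m, (i : ℕ) + 1 = j →
    a j / prefixGcd a j ∈ AddSubmonoid.closure {b | ∃ k ≤ i, b = a k / prefixGcd a i}

/-- A semigroup is telescopic if it is generated by a telescopic sequence. -/
def IsTelescopic (S : Set ℕ) : Prop :=
  ∃ (m : ℕ) (a : Fin m → ℕ), IsTelescopicSeq a ∧
    S = (AddSubmonoid.closure (Set.range a) : Set ℕ)

/-- A semigroup with `g` gaps is symmetric if `g` is finite and the largest gap is `2 g - 1`. -/
def IsSymmetric (S : Set ℕ) : Prop :=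
  Sᶜ.Finite ∧ ∃ l : ℕ, IsGreatest Sᶜ l ∧ l + 1 = 2 * Sᶜ.ncard

end Xnr

end

/-!
Subtracting the equation of the curve from its `q`-th power gives
`y ^ q ^ n - y = (x ^ q ^ n - x) * (x ^ q ^ r + x ^ q ^ (n - r))`, from which the valuations at
infinity of polynomials in `x` and `y` can be computed. One of them, `z`, has a pole of order prime
to `q ^ (n - 1)`, so `x = ∞` is totally ramified: this shows that the equation is irreducible and
that there is a single place at infinity.

The pole orders of `x`, `y` and three more functions, all regular elsewhere, form a telescopic
sequence. The semigroup `S` they generate is symmetric, so every strictly larger semigroup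
contains the largest gap `l = q ^ (n + r - 1) - q ^ r - 1` of `S`. But `l` is not a pole number.
The conjugates of `z` are its translates by the elements of `K` of trace zero (acting on `y`),
which gives the different exponent at infinity, and a function with pole divisor `l P` would have
a trace over `K(x)` that is a polynomial in `x` of degree `-1`.
-/

namespace Xnr

noncomputable section

open WithZero

section NumericalSemigroups

/-- `S`, seen as a set of integers, is exchanged with its complement by the reflection
`z ↦ l - z`. Working in `ℤ` allows `l = -1`, which is the case `S = ℕ`. -/
def IsSymmetricAbout (S : AddSubmonoid ℕ) (l : ℤ) : Prop :=
  ∀ z : ℤ, z ∈ ((↑) '' (S : Set ℕ) : Set ℤ) ↔ l - z ∉ ((↑) '' (S : Set ℕ) : Set ℤ)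

namespace IsSymmetricAbout

variable {S : AddSubmonoid ℕ} {l : ℕ}

lemma mem_iff_sub_notMem (hS : IsSymmetricAbout S l) {z : ℕ} (hz : z ≤ l) :
    z ∈ S ↔ l - z ∉ S := by
  have h := hS z
  rwa [← Nat.cast_sub hz, Nat.cast_injective.mem_set_image, Nat.cast_injective.mem_set_image] at h

lemma mem_of_lt (hS : IsSymmetricAbout S l) {z : ℕ} (hz : l < z) : z ∈ S := by
  refine Nat.cast_injective.mem_set_image.1 ((hS z).2 ?_)
  rintro ⟨s, -, hs⟩
  omega

lemma notMem (hS : IsSymmetricAbout S l) : l ∉ S := by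
  simpa using (hS.mem_iff_sub_notMem (Nat.zero_le l)).1 S.zero_mem

lemma compl_eq_image (hS : IsSymmetricAbout S l) :
    (S : Set ℕ)ᶜ = (l - ·) '' (Set.Iic l ∩ S) := by
  ext z
  constructor
  · intro hz
    have hzl : z ≤ l := not_lt.1 fun h ↦ hz (hS.mem_of_lt h)
    refine ⟨l - z, ⟨Nat.sub_le l z, ?_⟩, Nat.sub_sub_self hzl⟩
    exact not_not.1 (mt (hS.mem_iff_sub_notMem hzl).2 hz)
  · rintro ⟨s, ⟨hsl, hs⟩, rfl⟩
    exact (hS.mem_iff_sub_notMem hsl).1 hs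

theorem isSymmetric (hS : IsSymmetricAbout S l) : IsSymmetric (S : Set ℕ) := by
  have hle : (S : Set ℕ)ᶜ ⊆ Set.Iic l := fun z hz ↦ not_lt.1 fun h ↦ hz (hS.mem_of_lt h)
  refine ⟨(Set.finite_Iic l).subset hle, l, ⟨hS.notMem, hle⟩, ?_⟩
  have hcount := Set.ncard_inter_add_ncard_sdiff_eq_ncard (Set.Iic l) S (Set.finite_Iic l)
  have himage : (S : Set ℕ)ᶜ.ncard = (Set.Iic l ∩ S).ncard := by
    rw [hS.compl_eq_image, Set.InjOn.ncard_image]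
    intro a ha b hb hab
    have ha' : a ≤ l := ha.1
    have hb' : b ≤ l := hb.1
    dsimp only at hab
    omega
  rw [← himage, Set.sdiff_eq, Set.inter_eq_right.2 hle] at hcount
  simp only [← Finset.coe_Iic, Set.ncard_coe_finset, Nat.card_Iic] at hcount
  omega

lemma eq_of_le (hS : IsSymmetricAbout S l) {T : AddSubmonoid ℕ} (hST : S ≤ T) (hl : l ∉ T) :
    T = S := by
  refine le_antisymm (fun z hz ↦ not_not.1 fun hzS ↦ hl ?_) hST
  have hzl : z ≤ l := not_lt.1 fun h ↦ hzS (hS.mem_of_lt h)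
  have hsub : l - z ∈ S := not_not.1 (mt (hS.mem_iff_sub_notMem hzl).2 hzS)
  simpa [Nat.sub_add_cancel hzl] using T.add_mem (hST hsub) hz

end IsSymmetricAbout

lemma isSymmetricAbout_top : IsSymmetricAbout ⊤ (-1) := by
  have hrange : ∀ z : ℤ, z ∈ ((↑) '' ((⊤ : AddSubmonoid ℕ) : Set ℕ) : Set ℤ) ↔ 0 ≤ z := fun z ↦ by
    rw [AddSubmonoid.coe_top, Set.image_univ, Set.mem_range]
    exact ⟨fun ⟨s, hs⟩ ↦ hs ▸ Int.natCast_nonneg s, fun hz ↦ ⟨z.toNat, Int.toNat_of_nonneg hz⟩⟩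
  intro z
  rw [hrange, hrange]
  omega

lemma mem_closure_insert_image_mul {T : Set ℕ} {d a z : ℕ} :
    z ∈ AddSubmonoid.closure (insert a ((d * ·) '' T)) ↔
      ∃ s ∈ AddSubmonoid.closure T, ∃ j : ℕ, z = d * s + j * a := by
  rw [← Set.union_singleton, AddSubmonoid.closure_union,
    show (d * ·) '' T = AddMonoidHom.mulLeft d '' T from rfl, ← AddMonoidHom.map_mclosure]
  simp only [AddSubmonoid.mem_sup, AddSubmonoid.mem_map, AddSubmonoid.mem_closure_singleton,
    smul_eq_mul, AddMonoidHom.coe_mulLeft]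
  constructor
  · rintro ⟨_, ⟨s, hs, rfl⟩, _, ⟨j, rfl⟩, rfl⟩
    exact ⟨s, hs, j, rfl⟩
  · rintro ⟨s, hs, j, rfl⟩
    exact ⟨_, ⟨s, hs, rfl⟩, _, ⟨j, rfl⟩, rfl⟩

lemma exists_eq_mul_add_mul_of_coprime {d a : ℕ} (hd : 0 < d) (hda : Nat.Coprime d a) (z : ℤ) :
    ∃ w : ℤ, ∃ i < d, z = d * w + i * a := by
  obtain ⟨u, v, huv⟩ := Nat.isCoprime_iff_coprime.2 hda
  have hd' : (0 : ℤ) < d := by exact_mod_cast hd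
  have hcast : (((z * v) % d).toNat : ℤ) = (z * v) % d :=
    Int.toNat_of_nonneg (Int.emod_nonneg _ hd'.ne')
  have hlt := Int.emod_lt_of_pos (z * v) hd'
  refine ⟨z * u + (z * v) / d * a, ((z * v) % d).toNat, by omega, ?_⟩
  rw [hcast]
  linear_combination (-z) * huv - a * Int.emod_add_mul_ediv (z * v) d

lemma mul_add_mul_mem_closure_iff {T : Set ℕ} {d a : ℕ} (ha : a ∈ AddSubmonoid.closure T)
    (hda : Nat.Coprime d a) (w : ℤ) {i : ℕ} (hi : i < d) :
    (d * w + i * a : ℤ) ∈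
        ((↑) '' (AddSubmonoid.closure (insert a ((d * ·) '' T)) : Set ℕ) : Set ℤ) ↔
      w ∈ ((↑) '' (AddSubmonoid.closure T : Set ℕ) : Set ℤ) := by
  have hd' : (0 : ℤ) < d := by omega
  constructor
  · rintro ⟨t, ht, htw⟩
    obtain ⟨s, hs, j, rfl⟩ := mem_closure_insert_image_mul.1 ht
    push_cast at htw
    obtain ⟨k, hk⟩ : (d : ℤ) ∣ (j : ℤ) - i :=
      (Nat.isCoprime_iff_coprime.2 hda).dvd_of_dvd_mul_right
        ⟨w - s, by linear_combination htw⟩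
    have hk0 : 0 ≤ k := by
      by_contra! hneg
      nlinarith
    lift k to ℕ using hk0
    refine ⟨s + k * a, add_mem hs (by simpa using nsmul_mem ha k), ?_⟩
    apply mul_left_cancel₀ hd'.ne'
    push_cast
    linear_combination htw - a * hk
  · rintro ⟨s, hs, rfl⟩
    exact ⟨d * s + i * a, mem_closure_insert_image_mul.2 ⟨s, hs, i, rfl⟩, by push_cast; rfl⟩

/-- Every integer is `d * w + i * a` with `0 ≤ i < d`, and membership then depends on `w` only. -/
theorem IsSymmetricAbout.glue {T : Set ℕ} {l : ℤ}
    (hT : IsSymmetricAbout (AddSubmonoid.closure T) l) {d a : ℕ} (hd : 0 < d)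
    (ha : a ∈ AddSubmonoid.closure T) (hda : Nat.Coprime d a) :
    IsSymmetricAbout (AddSubmonoid.closure (insert a ((d * ·) '' T))) (d * l + (d - 1) * a) := by
  intro z
  obtain ⟨w, i, hi, rfl⟩ := exists_eq_mul_add_mul_of_coprime hd hda z
  have hreflect : (d * l + (d - 1) * a : ℤ) - (d * w + i * a) =
      d * (l - w) + ((d - 1 - i : ℕ) : ℤ) * a := by
    rw [Nat.sub_sub, Nat.cast_sub (by omega)]
    push_cast
    ring
  rw [hreflect, mul_add_mul_mem_closure_iff ha hda w hi,
    mul_add_mul_mem_closure_iff ha hda (l - w) (by omega)]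
  exact hT w

end NumericalSemigroups

section TelescopicSequences

variable {m : ℕ}

lemma prefixGcd_dvd (a : Fin m → ℕ) {k i : Fin m} (hki : k ≤ i) : prefixGcd a i ∣ a k :=
  Finset.gcd_dvd (Finset.mem_Iic.2 hki)

lemma prefixGcd_pos {a : Fin m → ℕ} {i : Fin m} (hi : 0 < a i) : 0 < prefixGcd a i :=
  Nat.pos_of_dvd_of_pos (prefixGcd_dvd a le_rfl) hi

lemma prefixGcd_zero (a : Fin (m + 1) → ℕ) : prefixGcd a 0 = a 0 := by
  have hIic : Finset.Iic (0 : Fin (m + 1)) = {0} := by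
    ext i
    simp
  rw [prefixGcd, hIic, Finset.gcd_singleton, normalize_eq]

lemma prefixGcd_succ (a : Fin (m + 1) → ℕ) (i : Fin m) :
    prefixGcd a i.succ = Nat.gcd (a i.succ) (prefixGcd a i.castSucc) := by
  have hIic : Finset.Iic i.succ = insert i.succ (Finset.Iic i.castSucc) := by
    ext j
    simp only [Finset.mem_Iic, Finset.mem_insert, Fin.le_def, Fin.ext_iff, Fin.val_succ,
      Fin.val_castSucc]
    omega
  rw [prefixGcd, hIic, Finset.gcd_insert]
  rfl

lemma prefixGcd_last (a : Fin (m + 1) → ℕ) : prefixGcd a (Fin.last m) = Finset.univ.gcd a := by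
  rw [prefixGcd, ← Fin.top_eq_last, Finset.Iic_top]

lemma prefixGcd_succ_eq {a : Fin (m + 1) → ℕ} {i : Fin m} {d e c : ℕ}
    (hd : prefixGcd a i.castSucc = d * e) (ha : a i.succ = d * c) (hec : Nat.Coprime e c) :
    prefixGcd a i.succ = d := by
  rw [prefixGcd_succ, hd, ha, Nat.gcd_mul_left, hec.symm.gcd_eq_one, mul_one]

/-- The sequence `a_1 / d, …, a_(m-1) / d` with `d = gcd(a_1, …, a_(m-1))`: a sequence
`a_1, …, a_m` is telescopic if this shorter one is, `a_m` lies in the semigroup it generates,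
and `a_m` is prime to `d`. -/
def reducedInit (a : Fin (m + 2) → ℕ) (i : Fin (m + 1)) : ℕ :=
  a i.castSucc / prefixGcd a (Fin.last m).castSucc

lemma mul_reducedInit (a : Fin (m + 2) → ℕ) (i : Fin (m + 1)) :
    prefixGcd a (Fin.last m).castSucc * reducedInit a i = a i.castSucc :=
  Nat.mul_div_cancel' (prefixGcd_dvd a (Fin.castSucc_le_castSucc_iff.2 (Fin.le_last i)))

lemma mul_prefixGcd_reducedInit (a : Fin (m + 2) → ℕ) (i : Fin (m + 1)) :
    prefixGcd a (Fin.last m).castSucc * prefixGcd (reducedInit a) i = prefixGcd a i.castSucc := by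
  induction i using Fin.induction with
  | zero => rw [prefixGcd_zero, mul_reducedInit, Fin.castSucc_zero, prefixGcd_zero]
  | succ i ih =>
    rw [prefixGcd_succ, ← Nat.gcd_mul_left, mul_reducedInit, ih, Fin.castSucc_succ, prefixGcd_succ]

lemma range_eq_insert_image_reducedInit (a : Fin (m + 2) → ℕ) :
    Set.range a = insert (a (Fin.last (m + 1)))
      ((prefixGcd a (Fin.last m).castSucc * ·) '' Set.range (reducedInit a)) := by
  rw [← Set.range_comp]
  simp only [Function.comp_def, mul_reducedInit]
  ext z
  simp only [Set.mem_range, Set.mem_insert_iff, Fin.exists_fin_succ', eq_comm (a := z), or_comm]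

/-- The largest gap of the semigroup generated by the telescopic sequence `a`, or `-1` if there is
no gap: `∑_{i ≥ 2} (d_(i-1) / d_i) a_i - ∑_i a_i`. -/
def telescopicFrobenius (a : Fin (m + 1) → ℕ) : ℤ :=
  ∑ i : Fin m, ((prefixGcd a i.castSucc / prefixGcd a i.succ * a i.succ : ℕ) : ℤ) - ∑ i, (a i : ℤ)

namespace IsTelescopicSeq

lemma of_recurrence {a : Fin (m + 1) → ℕ} (hpos : ∀ i, 0 < a i)
    (hgcd : prefixGcd a (Fin.last m) = 1) (t : Fin m → ℕ)
    (ht : ∀ i : Fin m, prefixGcd a i.castSucc * a i.succ =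
      prefixGcd a i.succ * (a i.castSucc + t i * a 0)) : IsTelescopicSeq a where
  pos := hpos
  gcd_eq_one := by rw [← prefixGcd_last, hgcd]
  mem i j hij := by
    have hjm : (i : ℕ) < m := by omega
    obtain ⟨k, rfl⟩ : ∃ k : Fin m, k.castSucc = i := ⟨⟨i, hjm⟩, rfl⟩
    obtain rfl : k.succ = j := Fin.ext hij
    have hquot : a k.succ / prefixGcd a k.succ =
        a k.castSucc / prefixGcd a k.castSucc + t k * (a 0 / prefixGcd a k.castSucc) := by
      have hd := prefixGcd_pos (hpos k.castSucc)
      rw [Nat.div_eq_iff_eq_mul_right (prefixGcd_pos (hpos _)) (prefixGcd_dvd a le_rfl)]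
      apply Nat.eq_of_mul_eq_mul_left hd
      rw [ht, mul_left_comm, mul_add (prefixGcd a k.castSucc), mul_left_comm _ (t k),
        Nat.mul_div_cancel' (prefixGcd_dvd a le_rfl),
        Nat.mul_div_cancel' (prefixGcd_dvd a (Fin.zero_le _))]
    rw [hquot, ← smul_eq_mul]
    exact add_mem (AddSubmonoid.subset_closure ⟨_, le_rfl, rfl⟩)
      (nsmul_mem (AddSubmonoid.subset_closure (by exact ⟨0, Fin.zero_le _, rfl⟩)) _)

variable {a : Fin (m + 2) → ℕ} (ha : IsTelescopicSeq a)

include ha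

lemma prefixGcd_last_eq_one : prefixGcd a (Fin.last (m + 1)) = 1 :=
  (prefixGcd_last a).trans ha.gcd_eq_one

lemma coprime_last : Nat.Coprime (prefixGcd a (Fin.last m).castSucc) (a (Fin.last (m + 1))) := by
  rw [Nat.coprime_comm, Nat.coprime_iff_gcd_eq_one, ← Fin.succ_last, ← prefixGcd_succ,
    Fin.succ_last, ha.prefixGcd_last_eq_one]

lemma last_mem_closure :
    a (Fin.last (m + 1)) ∈ AddSubmonoid.closure (Set.range (reducedInit a)) := by
  have hmem := ha.mem (Fin.last m).castSucc (Fin.last (m + 1)) (by simp)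
  rw [ha.prefixGcd_last_eq_one, Nat.div_one] at hmem
  refine AddSubmonoid.closure_mono ?_ hmem
  rintro _ ⟨k, hk, rfl⟩
  have hlt : k < Fin.last (m + 1) := hk.trans_lt (Fin.castSucc_lt_last _)
  exact ⟨k.castPred hlt.ne, by rw [reducedInit, Fin.castSucc_castPred]⟩

lemma reducedInit_div (i j : Fin (m + 1)) :
    reducedInit a i / prefixGcd (reducedInit a) j = a i.castSucc / prefixGcd a j.castSucc := by
  rw [← mul_reducedInit a i, ← mul_prefixGcd_reducedInit a j,
    Nat.mul_div_mul_left _ _ (prefixGcd_pos (ha.pos _))]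

lemma isTelescopicSeq_reducedInit : IsTelescopicSeq (reducedInit a) where
  pos i := Nat.pos_of_mul_pos_left ((mul_reducedInit a i).symm ▸ ha.pos _)
  gcd_eq_one := by
    have h := mul_prefixGcd_reducedInit a (Fin.last m)
    rwa [Nat.mul_eq_left (prefixGcd_pos (ha.pos _)).ne', prefixGcd_last] at h
  mem i j hij := by
    rw [ha.reducedInit_div]
    refine AddSubmonoid.closure_mono ?_ (ha.mem i.castSucc j.castSucc hij)
    rintro _ ⟨k, hk, rfl⟩
    have hlt : k < Fin.last (m + 1) := hk.trans_lt (Fin.castSucc_lt_last i)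
    refine ⟨k.castPred hlt.ne, Fin.castPred_le_iff hlt.ne |>.2 hk, ?_⟩
    rw [ha.reducedInit_div, Fin.castSucc_castPred]

lemma telescopicFrobenius_eq : telescopicFrobenius a =
    prefixGcd a (Fin.last m).castSucc * telescopicFrobenius (reducedInit a) +
      (prefixGcd a (Fin.last m).castSucc - 1) * a (Fin.last (m + 1)) := by
  have hsum (i : Fin (m + 1)) : (a i.castSucc : ℤ) =
      prefixGcd a (Fin.last m).castSucc * reducedInit a i := by
    rw [← mul_reducedInit a i, Nat.cast_mul]
  have hterm (i : Fin m) : ((prefixGcd a i.castSucc.castSucc / prefixGcd a i.castSucc.succ *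
      a i.castSucc.succ : ℕ) : ℤ) = prefixGcd a (Fin.last m).castSucc *
        ((prefixGcd (reducedInit a) i.castSucc / prefixGcd (reducedInit a) i.succ *
          reducedInit a i.succ : ℕ) : ℤ) := by
    rw [← Nat.cast_mul, mul_left_comm, mul_reducedInit, ← Fin.castSucc_succ,
      ← mul_prefixGcd_reducedInit a i.castSucc, ← mul_prefixGcd_reducedInit a i.succ,
      Nat.mul_div_mul_left _ _ (prefixGcd_pos (ha.pos _))]
  simp only [telescopicFrobenius]
  rw [Fin.sum_univ_castSucc, Fin.sum_univ_castSucc (fun i ↦ (a i : ℤ)), Fin.succ_last,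
    ha.prefixGcd_last_eq_one, Nat.div_one]
  simp only [hterm, hsum, ← Finset.mul_sum]
  push_cast
  ring

omit ha

theorem isSymmetricAbout {a : Fin (m + 1) → ℕ} (ha : IsTelescopicSeq a) :
    IsSymmetricAbout (AddSubmonoid.closure (Set.range a)) (telescopicFrobenius a) := by
  induction m with
  | zero =>
    have ha0 : a 0 = 1 :=
      (prefixGcd_zero a).symm.trans ((prefixGcd_last a).trans ha.gcd_eq_one)
    have hrange : Set.range a = {1} :=
      (Set.range_unique (ι := Fin 1)).trans (congrArg _ ha0)
    have hfrob : telescopicFrobenius a = -1 := by simp [telescopicFrobenius, ha0]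
    rw [hrange, hfrob, Nat.addSubmonoidClosure_one]
    exact isSymmetricAbout_top
  | succ m ih =>
    rw [range_eq_insert_image_reducedInit, ha.telescopicFrobenius_eq]
    exact (ih ha.isTelescopicSeq_reducedInit).glue (prefixGcd_pos (ha.pos _)) ha.last_mem_closure
      ha.coprime_last

end IsTelescopicSeq

end TelescopicSequences

section Generators

lemma isTelescopicSeq_self_succ {q : ℕ} (hq : 0 < q) : IsTelescopicSeq ![q, q + 1] := by
  have hgcd : prefixGcd ![q, q + 1] (Fin.succ 0) = 1 := by
    rw [prefixGcd_succ]
    simp [prefixGcd_zero]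
  refine .of_recurrence (fun i ↦ ?_) hgcd (fun _ ↦ q) fun i ↦ ?_
  · fin_cases i <;> simp [hq]
  · obtain rfl := Subsingleton.elim i 0
    rw [hgcd, Fin.castSucc_zero, prefixGcd_zero]
    simp [mul_add, add_comm]

lemma telescopicFrobenius_self_succ (q : ℕ) :
    telescopicFrobenius ![q, q + 1] = (q : ℤ) ^ 2 - q - 1 := by
  simp [telescopicFrobenius, prefixGcd_succ, prefixGcd_zero]
  ring

variable (q μ σ : ℕ)

/-- The five generators of the Weierstrass semigroup for `n > 2`. They are parametrised by
`μ = n - r - 1` and `σ = 2 * r - n - 1`, so that no exponent involves a subtraction. -/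
def semigroupGenerators : Fin 5 → ℕ :=
  ![q ^ (2 * μ + σ + 2), q ^ (2 * μ + σ + 2) + q ^ (μ + σ + 1), q ^ (2 * μ + σ + 3) + q ^ (μ + 1),
    q ^ (2 * μ + 2 * σ + 3) + q ^ μ,
    q ^ (2 * μ + 2 * σ + 4) - q ^ (2 * μ + σ + 3) + q ^ (μ + σ + 2) + 1]

lemma coprime_pow_mul_add_one (j t : ℕ) : Nat.Coprime (q ^ j) (q * t + 1) := by
  apply Nat.Coprime.pow_left
  simp

lemma semigroupGenerators_four : semigroupGenerators q μ σ 4 =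
    q ^ (2 * μ + σ + 3) * (q ^ (σ + 1) - 1) + q ^ (μ + σ + 2) + 1 := by
  rw [Nat.mul_sub_one, ← pow_add]
  simp only [semigroupGenerators, Matrix.cons_val]
  ring_nf

lemma prefixGcd_semigroupGenerators : prefixGcd (semigroupGenerators q μ σ) =
    ![q ^ (2 * μ + σ + 2), q ^ (μ + σ + 1), q ^ (μ + 1), q ^ μ, 1] := by
  have h₀ : prefixGcd (semigroupGenerators q μ σ) 0 = q ^ (2 * μ + σ + 2) := prefixGcd_zero _
  have h₁ : prefixGcd (semigroupGenerators q μ σ) 1 = q ^ (μ + σ + 1) :=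
    prefixGcd_succ_eq (i := (0 : Fin 4)) (e := q ^ (μ + 1)) (c := q * q ^ μ + 1)
      (h₀.trans (by ring)) (by simp [semigroupGenerators]; ring) (coprime_pow_mul_add_one ..)
  have h₂ : prefixGcd (semigroupGenerators q μ σ) 2 = q ^ (μ + 1) :=
    prefixGcd_succ_eq (i := (1 : Fin 4)) (e := q ^ σ) (c := q * q ^ (μ + σ + 1) + 1)
      (h₁.trans (by ring)) (by simp [semigroupGenerators]; ring) (coprime_pow_mul_add_one ..)
  have h₃ : prefixGcd (semigroupGenerators q μ σ) 3 = q ^ μ :=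
    prefixGcd_succ_eq (i := (2 : Fin 4)) (e := q ^ 1) (c := q * q ^ (μ + 2 * σ + 2) + 1)
      (h₂.trans (by ring)) (by simp [semigroupGenerators]; ring) (coprime_pow_mul_add_one ..)
  have h₄ : prefixGcd (semigroupGenerators q μ σ) 4 = 1 :=
    prefixGcd_succ_eq (i := (3 : Fin 4)) (e := q ^ μ)
      (c := q * (q ^ (2 * μ + σ + 2) * (q ^ (σ + 1) - 1) + q ^ (μ + σ + 1)) + 1)
      (h₃.trans (one_mul _).symm) ((semigroupGenerators_four q μ σ).trans (by ring))
      (coprime_pow_mul_add_one ..)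
  funext i
  fin_cases i
  exacts [h₀, h₁, h₂, h₃, h₄]

lemma isTelescopicSeq_semigroupGenerators (hq : 0 < q) :
    IsTelescopicSeq (semigroupGenerators q μ σ) := by
  have hpow : ∀ j, 0 < q ^ j := fun j ↦ Nat.pow_pos hq
  obtain ⟨A, hA⟩ := Nat.exists_eq_add_of_le' (hpow (μ + 1))
  obtain ⟨B, hB⟩ := Nat.exists_eq_add_of_le' (hpow (σ + 1))
  have hgcd := prefixGcd_semigroupGenerators q μ σ
  refine .of_recurrence (fun i ↦ ?_) (by rw [hgcd]; rfl) ![q ^ (μ + 1), B, q * B, A * B] fun i ↦ ?_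
  · fin_cases i <;> simp [semigroupGenerators, hpow]
  rw [hgcd]
  fin_cases i
  · change q ^ (2 * μ + σ + 2) * (q ^ (2 * μ + σ + 2) + q ^ (μ + σ + 1)) =
      q ^ (μ + σ + 1) * (q ^ (2 * μ + σ + 2) + q ^ (μ + 1) * q ^ (2 * μ + σ + 2))
    ring
  · change q ^ (μ + σ + 1) * (q ^ (2 * μ + σ + 3) + q ^ (μ + 1)) =
      q ^ (μ + 1) * (q ^ (2 * μ + σ + 2) + q ^ (μ + σ + 1) + B * q ^ (2 * μ + σ + 2))
    linear_combination q ^ (3 * μ + σ + 3) * hB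
  · change q ^ (μ + 1) * (q ^ (2 * μ + 2 * σ + 3) + q ^ μ) =
      q ^ μ * (q ^ (2 * μ + σ + 3) + q ^ (μ + 1) + q * B * q ^ (2 * μ + σ + 2))
    linear_combination q ^ (3 * μ + σ + 3) * hB
  · change q ^ μ * semigroupGenerators q μ σ 4 =
      1 * (q ^ (2 * μ + 2 * σ + 3) + q ^ μ + A * B * q ^ (2 * μ + σ + 2))
    rw [semigroupGenerators_four, hB, Nat.add_sub_cancel]
    linear_combination B * q ^ (2 * μ + σ + 2) * hA + q ^ (2 * μ + σ + 2) * hB.symm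

lemma telescopicFrobenius_semigroupGenerators (hq : 0 < q) :
    telescopicFrobenius (semigroupGenerators q μ σ) =
      (q : ℤ) ^ (3 * μ + 2 * σ + 4) - q ^ (μ + σ + 2) - 1 := by
  have hpow : ∀ j, 0 < q ^ j := fun j ↦ Nat.pow_pos hq
  have hpow' : ∀ j, (q : ℤ) ^ j ≠ 0 := fun j ↦ by exact_mod_cast (hpow j).ne'
  have hquot₁ : (q : ℤ) ^ (2 * μ + σ + 2) / q ^ (μ + σ + 1) = q ^ (μ + 1) :=
    Int.ediv_eq_of_eq_mul_left (hpow' _) (by ring)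
  have hquot₂ : (q : ℤ) ^ (μ + σ + 1) / q ^ (μ + 1) = q ^ σ :=
    Int.ediv_eq_of_eq_mul_left (hpow' _) (by ring)
  have hquot₃ : (q : ℤ) ^ (μ + 1) / q ^ μ = q := Int.ediv_eq_of_eq_mul_left (hpow' _) (by ring)
  have hsub : ((q ^ (σ + 1) - 1 : ℕ) : ℤ) = (q : ℤ) ^ (σ + 1) - 1 := by
    push_cast [Nat.cast_sub (hpow (σ + 1))]
    rfl
  have hfour : (semigroupGenerators q μ σ 4 : ℤ) =
      q ^ (2 * μ + σ + 3) * (q ^ (σ + 1) - 1) + q ^ (μ + σ + 2) + 1 := by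
    rw [semigroupGenerators_four]
    push_cast [hsub]
    rfl
  have hexpand : telescopicFrobenius (semigroupGenerators q μ σ) =
      q ^ (μ + 1) * semigroupGenerators q μ σ 1 + q ^ σ * semigroupGenerators q μ σ 2 +
        q * semigroupGenerators q μ σ 3 + q ^ μ * semigroupGenerators q μ σ 4 -
        (semigroupGenerators q μ σ 0 + semigroupGenerators q μ σ 1 + semigroupGenerators q μ σ 2 +
          semigroupGenerators q μ σ 3 + semigroupGenerators q μ σ 4) := by
    simp [telescopicFrobenius, prefixGcd_semigroupGenerators q μ σ, Fin.sum_univ_succ, hquot₁,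
      hquot₂, hquot₃]
    ring
  rw [hexpand, hfour]
  simp only [semigroupGenerators, Matrix.cons_val]
  push_cast
  ring

lemma range_semigroupGenerators : Set.range (semigroupGenerators q μ σ) =
    {q ^ (2 * μ + σ + 2), q ^ (2 * μ + σ + 2) + q ^ (μ + σ + 1), q ^ (2 * μ + σ + 3) + q ^ (μ + 1),
      q ^ (2 * μ + 2 * σ + 3) + q ^ μ,
      q ^ (2 * μ + 2 * σ + 4) - q ^ (2 * μ + σ + 3) + q ^ (μ + σ + 2) + 1} := by
  simp only [semigroupGenerators, Matrix.range_cons, Matrix.range_empty, Set.union_empty,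
    Set.singleton_union]

end Generators

section ValuesModuloSubfield

variable {k L Γ : Type*} [Field k] [Field L] [Algebra k L] [LinearOrderedCommGroupWithZero Γ]
  {v : Valuation L Γ} {ι : Type*}

lemma valuation_sum_eq_sup (s : Finset ι) (f : ι → L)
    (hf : ∀ i ∈ s, ∀ j ∈ s, i ≠ j → f i ≠ 0 → v (f i) ≠ v (f j)) :
    v (∑ i ∈ s, f i) = s.sup (fun i ↦ v (f i)) := by
  classical
  rcases s.eq_empty_or_nonempty with rfl | hs
  · rw [Finset.sum_empty, map_zero, Finset.sup_empty, bot_eq_zero]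
  obtain ⟨j, hj, hmax⟩ := s.exists_max_image (fun i ↦ v (f i)) hs
  have hsup : s.sup (fun i ↦ v (f i)) = v (f j) :=
    le_antisymm (Finset.sup_le hmax) (Finset.le_sup (f := fun i ↦ v (f i)) hj)
  rw [hsup]
  by_cases h0 : f j = 0
  · have hzero : ∀ i ∈ s, f i = 0 := fun i hi ↦ by simpa [h0] using hmax i hi
    rw [Finset.sum_eq_zero hzero, h0]
  · refine v.map_sum_eq_of_lt hj fun i hi ↦ ?_
    rw [Finset.mem_sdiff, Finset.mem_singleton] at hi
    exact lt_of_le_of_ne (hmax i hi.1) (hf j hj i hi.1 (Ne.symm hi.2) h0).symm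

variable (k v) in
/-- The `w i` are nonzero, and their values lie in distinct cosets of the value group of the
subfield `k`. -/
structure ValuesIncongruent (w : ι → L) : Prop where
  ne_zero : ∀ i, w i ≠ 0
  valuation_ne : ∀ i j, i ≠ j → ∀ c : k, v (w i) ≠ v (c • w j)

namespace ValuesIncongruent

variable {w : ι → L} (hw : ValuesIncongruent k v w)

include hw

lemma valuation_smul_ne {i j : ι} (hij : i ≠ j) {c : k} (hc : c ≠ 0) (c' : k) :
    v (c • w i) ≠ v (c' • w j) := by
  intro h
  refine hw.valuation_ne i j hij (c⁻¹ * c') ?_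
  rw [mul_smul, Algebra.smul_def c⁻¹, map_mul, ← h, ← map_mul, ← Algebra.smul_def, smul_smul,
    inv_mul_cancel₀ hc, one_smul]

lemma valuation_sum_smul (s : Finset ι) (c : ι → k) :
    v (∑ i ∈ s, c i • w i) = s.sup fun i ↦ v (c i • w i) :=
  valuation_sum_eq_sup s _ fun _ _ _ _ hij hi ↦
    hw.valuation_smul_ne hij (left_ne_zero_of_smul hi) _

theorem linearIndependent : LinearIndependent k w := by
  rw [linearIndependent_iff']
  intro s c hc i hi
  have hle : v (c i • w i) ≤ v (∑ j ∈ s, c j • w j) :=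
    (hw.valuation_sum_smul s c).symm ▸ Finset.le_sup (f := fun i ↦ v (c i • w i)) hi
  rw [hc, map_zero, le_zero_iff, v.zero_iff] at hle
  exact (smul_eq_zero.1 hle).resolve_right (hw.ne_zero i)

end ValuesIncongruent

end ValuesModuloSubfield

section PlacesOfDedekindDomains

open IsDedekindDomain

variable {K L : Type*} [Field K] [Field L] [Algebra K L]

lemma valuation_algebraMap_eq_one {Γ : Type*} [LinearOrderedCommGroupWithZero Γ]
    {v : Valuation L Γ} (hv : ∀ a : K, v (algebraMap K L a) ≤ 1) {a : K} (ha : a ≠ 0) :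
    v (algebraMap K L a) = 1 := by
  refine le_antisymm (hv a) ?_
  have hinv := hv a⁻¹
  rw [map_inv₀, map_inv₀] at hinv
  exact (inv_le_one₀ (by simpa [zero_lt_iff] using ha)).1 hinv

/-- The place of `L / K` given by a maximal ideal of a Dedekind domain `B` that contains the
constants and has field of fractions `L`. -/
def Place.ofHeightOneSpectrum {B : Type*} [CommRing B] [IsDedekindDomain B] [Algebra B L]
    [IsFractionRing B L] (hB : ∀ a : K, algebraMap K L a ∈ (algebraMap B L).range)
    (u : HeightOneSpectrum B) : Place K L where
  v := u.valuation L
  trivial_on_const _ := valuation_algebraMap_eq_one fun a ↦ by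
    obtain ⟨b, hb⟩ := hB a
    exact hb ▸ u.valuation_le_one b
  normalized := u.valuation_surjective L

lemma exists_heightOneSpectrum_valuation_lt_one (R F L : Type*) [CommRing R] [IsDedekindDomain R]
    [Field F] [Field L] [Algebra R F] [IsFractionRing R F] [Algebra R L] [Algebra F L]
    [IsScalarTower R F L] [IsDedekindDomain (integralClosure R L)]
    [IsFractionRing (integralClosure R L) L] {t : R} (ht : ¬ IsUnit t) (ht0 : t ≠ 0) :
    ∃ u : HeightOneSpectrum (integralClosure R L), u.valuation L (algebraMap R L t) < 1 := by
  have hinj : Function.Injective (algebraMap R L) := by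
    rw [IsScalarTower.algebraMap_eq R F L]
    exact (algebraMap F L).injective.comp (IsFractionRing.injective R F)
  have hinj' : Function.Injective (algebraMap R (integralClosure R L)) := by
    rw [IsScalarTower.algebraMap_eq R (integralClosure R L) L] at hinj
    exact .of_comp (f := algebraMap (integralClosure R L) L) hinj
  obtain ⟨m, hm, htm⟩ := exists_max_ideal_of_mem_nonunits ht
  obtain ⟨M, hM, rfl⟩ := Ideal.exists_ideal_over_maximal_of_isIntegral
    (S := integralClosure R L) m <| by
      rw [(RingHom.injective_iff_ker_eq_bot _).1 hinj']
      exact bot_le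
  have hM0 : M ≠ ⊥ := by
    rintro rfl
    exact ht0 (hinj' (htm.trans (map_zero _).symm))
  refine ⟨⟨M, hM.isPrime, hM0⟩, ?_⟩
  rw [IsScalarTower.algebraMap_apply R (integralClosure R L) L]
  exact (HeightOneSpectrum.valuation_lt_one_iff_mem _ _).2 htm

end PlacesOfDedekindDomains

section PlacesOfRatFuncExtensions

variable {K L : Type*} [Field K] [Field L] [Algebra K L] [Algebra (RatFunc K) L]

/-- The image of the variable in an extension of `K(X)`; a place lies over infinity if
`1 < P.v (ratX K L)`. -/
abbrev ratX (K L : Type*) [Field K] [Field L] [Algebra (RatFunc K) L] : L :=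
  algebraMap (RatFunc K) L RatFunc.X

lemma Place.valuation_algebraMap [IsScalarTower K (RatFunc K) L] (P : Place K L)
    (hP : 1 < P.v (ratX K L)) {c : RatFunc K} (hc : c ≠ 0) :
    P.v (algebraMap (RatFunc K) L c) = P.v (ratX K L) ^ c.intDegree := by
  let w := P.v.comap (algebraMap (RatFunc K) L)
  have : w.IsTrivialOn K := ⟨fun a ha ↦ by
    change P.v (algebraMap (RatFunc K) L (algebraMap K _ a)) = 1
    rw [← IsScalarTower.algebraMap_apply]
    exact P.trivial_on_const a ha⟩
  exact RatFunc.valuation_eq_valuation_X_zpow_intDegree_of_one_lt_valuation_X (v := w) hP hc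

/-- The place is a maximal ideal over `1 / X` of the integral closure of the valuation ring of
`K(X)` at infinity. -/
theorem exists_place_one_lt (K L : Type*) [Field K] [Field L] [Algebra K L] [Algebra (RatFunc K) L]
    [IsScalarTower K (RatFunc K) L] [FiniteDimensional (RatFunc K) L]
    [Algebra.IsSeparable (RatFunc K) L] : ∃ P : Place K L, 1 < P.v (ratX K L) := by
  classical
  let w := RatFunc.inftyValuation K
  let R := w.valuationSubring
  have : IsCyclic (ℤᵐ⁰)ˣ :=
    isCyclic_of_surjective (WithZero.unitsWithZeroEquiv (α := Multiplicative ℤ)).symm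
      (MulEquiv.surjective _)
  have : IsDedekindDomain (integralClosure R L) :=
    integralClosure.isDedekindDomain R (RatFunc K) L
  have : IsFractionRing (integralClosure R L) L :=
    integralClosure.isFractionRing_of_finite_extension (RatFunc K) L
  have hX : w RatFunc.X⁻¹ < 1 := by
    rw [map_inv₀, RatFunc.inftyValuation.X, ← WithZero.exp_neg, ← WithZero.exp_zero,
      WithZero.exp_lt_exp]
    norm_num
  let t : R := ⟨RatFunc.X⁻¹, hX.le⟩
  have ht : ¬ IsUnit t := fun h ↦ hX.ne ((Valuation.integer.integers w).one_of_isUnit h)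
  have ht0 : t ≠ 0 := fun h ↦ inv_ne_zero RatFunc.X_ne_zero (congrArg Subtype.val h)
  obtain ⟨u, hu⟩ := exists_heightOneSpectrum_valuation_lt_one R (RatFunc K) L ht ht0
  have hconst : ∀ a : K, algebraMap K L a ∈ (algebraMap (integralClosure R L) L).range := fun a ↦ by
    have ha : w (algebraMap K (RatFunc K) a) ≤ 1 := by
      by_cases h : a = 0
      · simp [h]
      · exact (RatFunc.inftyValuation.C K h).le
    exact ⟨algebraMap R _ ⟨algebraMap K (RatFunc K) a, ha⟩,
      (IsScalarTower.algebraMap_apply K (RatFunc K) L a).symm⟩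
  refine ⟨.ofHeightOneSpectrum hconst u, ?_⟩
  have htX : algebraMap R L t = (ratX K L)⁻¹ := map_inv₀ (algebraMap (RatFunc K) L) RatFunc.X
  rw [htX] at hu
  exact (Valuation.one_lt_val_iff _ (by simp [RatFunc.X_ne_zero])).2 hu

variable [Algebra K[X] L] [IsScalarTower K[X] (RatFunc K) L] [FiniteDimensional (RatFunc K) L]

theorem isIntegral_of_forall_place [IsScalarTower K K[X] L] [Algebra.IsSeparable (RatFunc K) L]
    {f : L} (hf : ∀ Q : Place K L, Q.v (ratX K L) ≤ 1 → Q.v f ≤ 1) : IsIntegral K[X] f := by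
  set B := integralClosure K[X] L
  have : IsDedekindDomain B := integralClosure.isDedekindDomain K[X] (RatFunc K) L
  have : IsFractionRing B L :=
    integralClosure.isFractionRing_of_finite_extension (RatFunc K) L
  have hpoly (p : K[X]) : algebraMap K[X] L p ∈ (algebraMap B L).range := ⟨algebraMap K[X] B p, rfl⟩
  have hconst (a : K) : algebraMap K L a ∈ (algebraMap B L).range := by
    rw [IsScalarTower.algebraMap_apply K K[X] L]
    exact hpoly _
  have hle (u : IsDedekindDomain.HeightOneSpectrum B) : u.valuation L f ≤ 1 := by
    refine hf (.ofHeightOneSpectrum hconst u) ?_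
    obtain ⟨b, hb⟩ := hpoly X
    rw [ratX, ← RatFunc.algebraMap_X, ← IsScalarTower.algebraMap_apply, ← hb]
    exact u.valuation_le_one b
  obtain ⟨g, rfl⟩ := IsDedekindDomain.HeightOneSpectrum.mem_integers_of_valuation_le_one L f hle
  exact g.2

omit [Algebra K L] in
lemma zero_le_intDegree_trace {f : L} (hf : IsIntegral K[X] f) :
    0 ≤ (Algebra.trace (RatFunc K) L f).intDegree := by
  obtain ⟨p, hp⟩ := IsIntegrallyClosed.isIntegral_iff.1
    (Algebra.isIntegral_trace (L := RatFunc K) hf)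
  rw [← hp, RatFunc.intDegree_polynomial]
  positivity

end PlacesOfRatFuncExtensions

/-- Euler's formula: the last element of the basis dual to the powers of `z` for the trace form
is `1 / m'(z)`, where `m` is the minimal polynomial. -/
lemma repr_mul_aeval_derivative_minpoly {k L : Type*} [Field k] [Field L] [Algebra k L]
    [FiniteDimensional k L] [Algebra.IsSeparable k L] (pb : PowerBasis k L) (f : L)
    {i : Fin pb.dim} (hi : (i : ℕ) + 1 = pb.dim) :
    pb.basis.repr (f * aeval pb.gen (derivative (minpoly k pb.gen))) i = Algebra.trace k L f := by
  set D := aeval pb.gen (derivative (minpoly k pb.gen))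
  have hgen := Algebra.IsIntegral.isIntegral (R := k) pb.gen
  have hD : D ≠ 0 := (Algebra.IsSeparable.isSeparable k pb.gen).aeval_derivative_ne_zero
    (minpoly.aeval k pb.gen)
  have hdual : pb.basis.traceDual i = D⁻¹ := by
    have hlead := minpolyDiv_monic hgen
    have hdeg : (minpolyDiv k pb.gen).natDegree = i := by
      have := natDegree_minpolyDiv_succ hgen
      rw [pb.natDegree_minpoly] at this
      omega
    rw [Monic, leadingCoeff, hdeg] at hlead
    rw [Module.Basis.traceDual_powerBasis_eq, hlead, one_div]
  rw [← pb.basis.traceDual_traceDual, Module.Basis.traceDual_repr_apply, hdual,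
    Algebra.traceForm_apply, mul_inv_cancel_right₀ hD]

lemma exists_powerBasis_gen_eq {k L : Type*} [Field k] [Field L] [Algebra k L] {z : L}
    (hz : IsIntegral k z) (htop : IntermediateField.adjoin k {z} = ⊤) :
    ∃ pb : PowerBasis k L, pb.gen = z :=
  ⟨(IntermediateField.adjoin.powerBasis hz).map
    ((IntermediateField.equivOfEq htop).trans IntermediateField.topEquiv), by simp⟩

section RamificationAtInfinity

variable {K L : Type*} [Field K] [Field L] [Algebra K L] [Algebra (RatFunc K) L]

lemma Place.valuation_smul [IsScalarTower K (RatFunc K) L] (P : Place K L) {a : ℤ} (ha : 0 < a)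
    (hx : P.v (ratX K L) = exp a) {c : RatFunc K} (hc : c ≠ 0) {w : L} {d : ℤ}
    (hw : P.v w = exp d) : P.v (c • w) = exp (c.intDegree * a + d) := by
  have hP : 1 < P.v (ratX K L) := by rwa [hx, ← exp_zero, exp_lt_exp]
  rw [Algebra.smul_def, map_mul, P.valuation_algebraMap hP hc, hx, hw, ← exp_zsmul, ← exp_add,
    smul_eq_mul]

lemma Place.valuesIncongruent [IsScalarTower K (RatFunc K) L] (P : Place K L) {a : ℤ} (ha : 0 < a)
    (hx : P.v (ratX K L) = exp a) {ι : Type*} {w : ι → L} {d : ι → ℤ}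
    (hw : ∀ i, P.v (w i) = exp (d i)) (hd : ∀ i j, i ≠ j → ¬ a ∣ d i - d j) :
    ValuesIncongruent (RatFunc K) P.v w where
  ne_zero i := P.v.ne_zero_iff.1 (hw i ▸ exp_ne_zero)
  valuation_ne i j hij c h := by
    by_cases hc : c = 0
    · rw [hc, zero_smul, map_zero, hw] at h
      exact exp_ne_zero h
    · rw [P.valuation_smul ha hx hc (hw j), hw, exp_inj] at h
      exact hd i j hij ⟨c.intDegree, by linear_combination h⟩

lemma not_dvd_mul_sub {N b : ℕ} (hb : N.Coprime b) {i j : Fin N} (hij : i ≠ j) :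
    ¬ (N : ℤ) ∣ (i * b : ℤ) - j * b := by
  rw [← sub_mul]
  intro h
  have hdvd := (Nat.isCoprime_iff_coprime.2 hb).dvd_of_dvd_mul_right h
  have hzero := Int.eq_zero_of_abs_lt_dvd hdvd (by rw [abs_lt]; omega)
  omega

omit [Algebra (RatFunc K) L] in
lemma Place.valuation_pow (P : Place K L) {z : L} {b : ℕ} (hz : P.v z = exp (b : ℤ)) (i : ℕ) :
    P.v (z ^ i) = exp (i * b : ℤ) := by
  rw [map_pow, hz, ← exp_nsmul, nsmul_eq_mul]

lemma Place.valuesIncongruent_pow [IsScalarTower K (RatFunc K) L] (P : Place K L) {N b : ℕ}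
    (hN : 0 < N) (hb : N.Coprime b) {z : L} (hx : P.v (ratX K L) = exp (N : ℤ))
    (hz : P.v z = exp (b : ℤ)) :
    ValuesIncongruent (RatFunc K) P.v fun i : Fin N ↦ z ^ (i : ℕ) :=
  P.valuesIncongruent (by exact_mod_cast hN) hx (fun i ↦ P.valuation_pow hz i)
    fun _ _ ↦ not_dvd_mul_sub hb

lemma Place.le_finrank [IsScalarTower K (RatFunc K) L] [FiniteDimensional (RatFunc K) L]
    (P : Place K L) {a : ℕ} (ha : 0 < a) (hx : P.v (ratX K L) = exp (a : ℤ)) :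
    a ≤ Module.finrank (RatFunc K) L := by
  obtain ⟨t, ht⟩ := P.normalized (exp 1)
  have hli := (P.valuesIncongruent_pow (b := 1) ha (Nat.coprime_one_right a) hx
    (by exact_mod_cast ht)).linearIndependent
  simpa using hli.fintype_card_le_finrank

/-- The place `P` of `L` lies over infinity and is totally ramified over `K(X)`, with ramification
index `N`, and `z` has a pole at `P` of order `b` prime to `N`. Total ramification is encoded by
`[L : K(X)] = N`. -/
structure Place.IsTotallyRamified (P : Place K L) (N b : ℕ) (z : L) : Prop where
  pos : 0 < N
  coprime : N.Coprime b
  valuation_ratX : P.v (ratX K L) = exp (N : ℤ)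
  valuation_gen : P.v z = exp (b : ℤ)
  finrank_eq : Module.finrank (RatFunc K) L = N

/-- Comparing pole orders, `N` divides the ramification index at `P`, which is at most the
degree. -/
theorem Place.isTotallyRamified [IsScalarTower K (RatFunc K) L] [FiniteDimensional (RatFunc K) L]
    (P : Place K L) {N b : ℕ} {z : L} (hN : 0 < N) (hb : N.Coprime b)
    (hfin : Module.finrank (RatFunc K) L ≤ N) (hx : 1 < P.v (ratX K L))
    (hz : P.v z ^ N = P.v (ratX K L) ^ b) : P.IsTotallyRamified N b z := by
  have hx0 : P.v (ratX K L) ≠ 0 := ne_zero_of_lt hx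
  have hz0 : P.v z ≠ 0 := by
    intro h
    rw [h, zero_pow hN.ne'] at hz
    exact pow_ne_zero b hx0 hz.symm
  obtain ⟨a, ha⟩ : ∃ a, P.v (ratX K L) = exp a := ⟨_, (exp_log hx0).symm⟩
  obtain ⟨d, hd⟩ : ∃ d, P.v z = exp d := ⟨_, (exp_log hz0).symm⟩
  have ha0 : 0 < a := by rwa [ha, ← exp_zero, exp_lt_exp] at hx
  lift a to ℕ using ha0.le
  have ha0' : 0 < a := by exact_mod_cast ha0
  rw [ha, hd, ← exp_nsmul, ← exp_nsmul, exp_inj, nsmul_eq_mul, nsmul_eq_mul] at hz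
  have hdvd : (N : ℤ) ∣ a := (Nat.isCoprime_iff_coprime.2 hb).dvd_of_dvd_mul_left ⟨d, hz.symm⟩
  have hNa : N ≤ a := Nat.le_of_dvd ha0' (Int.natCast_dvd_natCast.1 hdvd)
  have hafin := P.le_finrank ha0' ha
  obtain rfl : a = N := by omega
  have hdb : d = b := mul_left_cancel₀ ha0.ne' (by rw [hz, mul_comm])
  exact ⟨hN, hb, ha, hdb ▸ hd, by omega⟩

namespace Place.IsTotallyRamified

variable [IsScalarTower K (RatFunc K) L] {P Q : Place K L} {N b : ℕ} {z : L}

lemma valuesIncongruent (hP : P.IsTotallyRamified N b z) :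
    ValuesIncongruent (RatFunc K) P.v fun i : Fin N ↦ z ^ (i : ℕ) :=
  P.valuesIncongruent_pow hP.pos hP.coprime hP.valuation_ratX hP.valuation_gen

lemma valuation_smul_pow (hP : P.IsTotallyRamified N b z) {c : RatFunc K} (hc : c ≠ 0) (i : ℕ) :
    P.v (c • z ^ i) = exp (c.intDegree * N + i * b : ℤ) :=
  P.valuation_smul (by exact_mod_cast hP.pos) hP.valuation_ratX hc
    (P.valuation_pow hP.valuation_gen i)

variable [FiniteDimensional (RatFunc K) L]

lemma natDegree_minpoly (hP : P.IsTotallyRamified N b z) :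
    (minpoly (RatFunc K) z).natDegree = N := by
  refine le_antisymm (hP.finrank_eq ▸ minpoly.natDegree_le z) ?_
  by_contra! hlt
  have hli := hP.valuesIncongruent.linearIndependent
  rw [Fintype.linearIndependent_iff] at hli
  have hrel : ∑ i : Fin N, (minpoly (RatFunc K) z).coeff i • z ^ (i : ℕ) = 0 := by
    rw [Fin.sum_univ_eq_sum_range (fun i ↦ (minpoly (RatFunc K) z).coeff i • z ^ i),
      ← aeval_eq_sum_range' hlt, minpoly.aeval]
  have hmonic := minpoly.monic (Algebra.IsIntegral.isIntegral (R := RatFunc K) z)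
  exact one_ne_zero (hmonic.coeff_natDegree.symm.trans (hli _ hrel ⟨_, hlt⟩))

lemma exists_powerBasis (hP : P.IsTotallyRamified N b z) :
    ∃ pb : PowerBasis (RatFunc K) L, pb.gen = z := by
  have htop := (Field.primitive_element_iff_minpoly_natDegree_eq (RatFunc K) z).2
    (hP.natDegree_minpoly.trans hP.finrank_eq.symm)
  exact exists_powerBasis_gen_eq (Algebra.IsIntegral.isIntegral z) htop

theorem eq (hP : P.IsTotallyRamified N b z) (hQ : Q.IsTotallyRamified N b z) : P = Q := by
  obtain ⟨pb, rfl⟩ := hP.exists_powerBasis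
  obtain rfl : pb.dim = N := pb.finrank.symm.trans hP.finrank_eq
  ext f
  rw [← pb.basis.sum_repr f]
  simp only [pb.coe_basis]
  rw [hP.valuesIncongruent.valuation_sum_smul, hQ.valuesIncongruent.valuation_sum_smul]
  congr 1
  funext i
  by_cases h : pb.basis.repr f i = 0
  · rw [h, zero_smul, map_zero, map_zero]
  · rw [hP.valuation_smul_pow h, hQ.valuation_smul_pow h]

/-- If `δ` is the pole order of the different `m'(z)`, the pole order of `f * m'(z)` is congruent
to that of `z ^ (N - 1)`, so its coordinate at `z ^ (N - 1)`, the trace of `f`, is the dominant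
one. -/
theorem intDegree_trace_eq_neg_one [Algebra.IsSeparable (RatFunc K) L]
    (hP : P.IsTotallyRamified N b z) {δ : ℤ}
    (hδ : P.v (aeval z (derivative (minpoly (RatFunc K) z))) = exp δ) {f : L}
    (hf : P.v f = exp ((N - 1) * b - δ - N)) :
    (Algebra.trace (RatFunc K) L f).intDegree = -1 := by
  have hN : (N : ℤ) ≠ 0 := by exact_mod_cast hP.pos.ne'
  obtain ⟨pb, rfl⟩ := hP.exists_powerBasis
  obtain rfl : pb.dim = N := pb.finrank.symm.trans hP.finrank_eq
  set g := f * aeval pb.gen (derivative (minpoly (RatFunc K) pb.gen)) with hg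
  obtain ⟨last, hlast⟩ : ∃ i : Fin pb.dim, (i : ℕ) + 1 = pb.dim :=
    ⟨⟨pb.dim - 1, Nat.sub_one_lt hP.pos.ne'⟩, Nat.sub_one_add_one hP.pos.ne'⟩
  have hlast' : ((last : ℕ) : ℤ) = pb.dim - 1 := by omega
  have hgv : P.v g = exp (-(pb.dim : ℤ) + last * b) := by
    rw [hg, map_mul, hf, hδ, ← exp_add, hlast']
    congr 1
    ring
  have hsup := hP.valuesIncongruent.valuation_sum_smul Finset.univ (pb.basis.repr g)
  obtain ⟨i, -, hi⟩ := Finset.exists_mem_eq_sup Finset.univ ⟨last, Finset.mem_univ _⟩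
    fun i : Fin pb.dim ↦ P.v (pb.basis.repr g i • pb.gen ^ (i : ℕ))
  have hgi : exp (-(pb.dim : ℤ) + last * b) = P.v (pb.basis.repr g i • pb.gen ^ (i : ℕ)) := by
    rw [← hgv, ← hi, ← hsup]
    conv_lhs => rw [← pb.basis.sum_repr g]
    simp only [pb.coe_basis]
  have hc : pb.basis.repr g i ≠ 0 := by
    intro h
    rw [h, zero_smul, map_zero] at hgi
    exact exp_ne_zero hgi
  rw [hP.valuation_smul_pow hc, exp_inj] at hgi
  obtain rfl : i = last := by
    by_contra hne
    exact not_dvd_mul_sub hP.coprime hne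
      ⟨-1 - (pb.basis.repr g i).intDegree, by linear_combination -hgi⟩
  rw [repr_mul_aeval_derivative_minpoly pb f hlast] at hgi
  exact mul_right_cancel₀ hN (by linear_combination -hgi)

end Place.IsTotallyRamified

end RamificationAtInfinity

lemma two_mul_pow_le {q i j : ℕ} (hq : 2 ≤ q) (hij : i < j) : 2 * q ^ i ≤ q ^ j :=
  calc 2 * q ^ i ≤ q * q ^ i := by gcongr
    _ = q ^ (i + 1) := (pow_succ' q i).symm
    _ ≤ q ^ j := Nat.pow_le_pow_right (by omega) hij

lemma charP_of_expChar_of_prime (R : Type*) [AddMonoidWithOne R] {p : ℕ} (hp : p.Prime)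
    [h : ExpChar R p] : CharP R p := by
  cases h with
  | zero => exact absurd hp Nat.not_prime_one
  | prime => assumption

/-- The exponents attached to the curve: `q = p ^ k` is the prime power, `m = n - r`, and
`r s = 1 + n t` is a Bézout relation. -/
structure Exponents where
  (p k n r m s t : ℕ)
  prime : p.Prime
  k_pos : 0 < k
  m_pos : 0 < m
  m_le : m ≤ r
  n_eq : n = r + m
  bezout : r * s = 1 + n * t
  odd_of_eq : m = r → Odd p

namespace Exponents

variable (e : Exponents)

/-- The prime power `q`. -/
def q : ℕ := e.p ^ e.k

lemma two_le_q : 2 ≤ e.q := e.prime.two_le.trans (Nat.le_self_pow e.k_pos.ne' _)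

lemma q_pos : 0 < e.q := by have := e.two_le_q; omega

lemma n_pos : 0 < e.n := by have := e.m_pos; have := e.n_eq; omega

lemma r_pos : 0 < e.r := e.m_pos.trans_le e.m_le

lemma r_eq_one_of_eq (h : e.m = e.r) : e.r = 1 := by
  have hdvd : e.r ∣ e.n := ⟨2, by have := e.n_eq; omega⟩
  exact Nat.dvd_one.1 <| (Nat.dvd_add_left (hdvd.mul_right e.t)).1 ⟨e.s, e.bezout.symm⟩

lemma charP (R : Type*) [AddMonoidWithOne R] [ExpChar R e.p] : CharP R e.p :=
  charP_of_expChar_of_prime R e.prime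

lemma exists_eq {q n r : ℕ} (hq : IsPrimePow q) (hn : 2 ≤ n) (hr : n ≤ 2 * r) (hrn : r ≤ n - 1)
    (hnr : n.gcd r = 1) (hodd : n = 2 → Odd q) :
    ∃ e : Exponents, e.q = q ∧ e.n = n ∧ e.r = r := by
  obtain ⟨p, k, hp, hk, rfl⟩ := (isPrimePow_nat_iff q).1 hq
  obtain ⟨s, -, hs⟩ := Nat.exists_mul_mod_eq_one_of_coprime (Nat.Coprime.symm hnr) (by omega)
  have hbezout : r * s = 1 + n * (r * s / n) := by
    have := Nat.mod_add_div (r * s) n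
    omega
  refine ⟨⟨p, k, n, r, n - r, s, r * s / n, hp, hk, by omega, by omega, by omega, hbezout,
    fun h ↦ ?_⟩, rfl, rfl, rfl⟩
  obtain rfl : r = 1 := by rwa [show n = 2 * r by omega, Nat.gcd_mul_left_left] at hnr
  exact (Nat.odd_pow_iff hk.ne').1 (hodd (by omega))

section Frobenius

variable {B B' : Type*} [CommRing B] [CommRing B'] [ExpChar B e.p] [ExpChar B' e.p]

/-- The ring endomorphism `a ↦ a ^ q ^ i`. -/
def frob (i : ℕ) : B →+* B := iterateFrobenius B e.p (e.k * i)

local notation "φ" => Exponents.frob e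

lemma frob_apply (i : ℕ) (a : B) : φ i a = a ^ e.q ^ i := by
  rw [frob, iterateFrobenius_def, pow_mul, q]

lemma frob_frob (i j : ℕ) (a : B) : φ i (φ j a) = φ (i + j) a := by
  rw [frob_apply, frob_apply, frob_apply, ← pow_mul, ← pow_add, add_comm j]

lemma frob_zero (a : B) : φ 0 a = a := by rw [frob_apply, pow_zero, pow_one]

lemma frob_comm (i j : ℕ) (a : B) : φ i (φ j a) = φ j (φ i a) := by
  rw [frob_frob, frob_frob, add_comm]

lemma frob_one_frob (i : ℕ) (a : B) : φ 1 (φ i a) = φ (i + 1) a := by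
  rw [frob_frob, add_comm]

lemma map_frob (f : B →+* B') (i : ℕ) (a : B) : f (φ i a) = φ i (f a) := by
  rw [frob_apply, frob_apply, map_pow]

lemma frob_mul_of_frob_eq {n : ℕ} {a : B} (ha : φ n a = a) (i : ℕ) : φ (n * i) a = a := by
  induction i with
  | zero => rw [mul_zero, frob_zero]
  | succ i ih => rw [mul_add_one, ← frob_frob, ha, ih]

lemma sum_frob_sub (c j s : ℕ) (a : B) :
    ∑ i ∈ Finset.range s, φ (c + j * i) (φ j a - a) = φ (c + j * s) a - φ c a := by
  have h := Finset.sum_range_sub (fun i ↦ φ (c + j * i) a) s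
  rw [mul_zero, add_zero] at h
  rw [← h]
  refine Finset.sum_congr rfl fun i _ ↦ ?_
  rw [map_sub, frob_frob, mul_add_one, add_assoc]

lemma frob_sum_sub_sum (j : ℕ) (a : B) :
    φ 1 (∑ i ∈ Finset.range j, φ i a) - ∑ i ∈ Finset.range j, φ i a = φ j a - a := by
  have h := e.sum_frob_sub 0 1 j a
  simp only [zero_add, one_mul, frob_zero, map_sub, Finset.sum_sub_distrib,
    fun i ↦ e.frob_comm i 1 a] at h
  rwa [map_sum]

end Frobenius

section Functions

variable {B : Type*} [CommRing B] [ExpChar B e.p]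

local notation "φ" => Exponents.frob e

/-- The equation obtained from the equation `T_n(y) = f_r(x)` of the curve by subtracting it from
its `q`-th power. -/
def FrobeniusEquation (x y : B) : Prop :=
  φ e.n y - y = (φ e.n x - x) * (φ e.r x + φ e.m x)

/-- The function `h = x ^ q ^ m (x ^ q ^ n - x)`, from which `uFun` is built. -/
def hFun (x : B) : B := φ e.m x * (φ e.n x - x)

/-- The function `u` with `u ^ q ^ n - u = h - h ^ q` (see `frob_uFun_sub_uFun`), where `h` is
`hFun`. Its pole order at infinity is `q ^ n + q ^ m`. -/
def uFun (x y : B) : B :=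
  ∑ i ∈ Finset.range e.s, φ (e.r * i) (y - φ e.r x * x) +
    ∑ i ∈ Finset.range e.t, φ (1 + e.n * i) (e.hFun x)

omit [ExpChar B e.p] in
/-- The power `M` of `x` such that `M x = x ^ q ^ (r - m)`. -/
def monom (x : B) : B := x ^ (e.q ^ (e.r - e.m) - 1)

/-- A function with pole order `q ^ (2 r - 1) + q ^ (m - 1)` at infinity if `m < r`. -/
def wFun (x y : B) : B :=
  φ e.r y - φ e.r x * φ (e.r - e.m) x - φ e.r x * x + y * e.monom x

/-- A function with pole order `q ^ (2 r) - q ^ n + q ^ r + 1` at infinity if `m < r`. -/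
def zFun (x y : B) : B :=
  φ 1 (e.wFun x y) + φ 1 (e.monom x) * e.uFun x y - e.monom x ^ (e.q - 1) * e.wFun x y

/-- A function with pole order `q ^ (2 r) - q ^ n + q ^ r + 1` at infinity: if `m = r`, then
`r = 1`, `n = 2`, and `y` is such a function. -/
def coprimeFun (x y : B) : B := if e.m < e.r then e.zFun x y else y

variable {e} {x y : B}

omit [ExpChar B e.p] in
lemma monom_pow_mul_self : e.monom x ^ (e.q - 1) * e.monom x = e.monom x ^ e.q :=
  pow_sub_one_mul e.q_pos.ne' _

lemma monom_mul_self : e.monom x * x = φ (e.r - e.m) x := by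
  rw [monom, frob_apply, pow_sub_one_mul (pow_pos e.q_pos _).ne']

lemma frob_one (a : B) : φ 1 a = a ^ e.q := by rw [frob_apply, pow_one]

lemma map_coprimeFun {B' : Type*} [CommRing B'] [ExpChar B' e.p] (f : B →+* B') (x y : B) :
    f (e.coprimeFun x y) = e.coprimeFun (f x) (f y) := by
  have hmonom (a : B) : f (e.monom a) = e.monom (f a) := map_pow f a _
  simp only [coprimeFun, apply_ite f, zFun, wFun, uFun, hFun, hmonom, map_add f, map_sub f,
    map_mul f, map_pow f, map_sum f, e.map_frob f]

namespace FrobeniusEquation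

variable (h : e.FrobeniusEquation x y)

include h

lemma frob_sub_self : φ e.n (y - φ e.r x * x) - (y - φ e.r x * x) =
    -(φ e.r (e.hFun x) - e.hFun x) := by
  have hrm : φ e.r (φ e.m x) = φ e.n x := by rw [frob_frob, e.n_eq]
  unfold FrobeniusEquation at h
  simp only [hFun, map_sub, map_mul, frob_comm e e.n e.r x, hrm]
  linear_combination h

lemma frob_uFun_sub_uFun :
    φ e.n (e.uFun x y) - e.uFun x y = e.hFun x - φ 1 (e.hFun x) := by
  have hr := e.sum_frob_sub 0 e.r e.s (e.hFun x)
  have hn := e.sum_frob_sub 1 e.n e.t (e.hFun x)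
  have hcomm (c j : ℕ) (N : ℕ) (a : B) : φ c (∑ i ∈ Finset.range N, φ (j * i) a) =
      ∑ i ∈ Finset.range N, φ (j * i) (φ c a) := by
    rw [map_sum]
    exact Finset.sum_congr rfl fun i _ ↦ e.frob_comm _ _ _
  rw [frob_zero, zero_add, e.bezout] at hr
  simp only [zero_add] at hr
  calc φ e.n (e.uFun x y) - e.uFun x y
      = ∑ i ∈ Finset.range e.s, φ (e.r * i) (φ e.n (y - φ e.r x * x) - (y - φ e.r x * x)) +
          ∑ i ∈ Finset.range e.t, φ (1 + e.n * i) (φ e.n (e.hFun x) - e.hFun x) := by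
        rw [uFun, map_add, map_sum, map_sum]
        simp only [map_sub (φ _), Finset.sum_sub_distrib, e.frob_comm e.n]
        ring
    _ = e.hFun x - φ 1 (e.hFun x) := by
        simp only [h.frob_sub_self, map_neg, Finset.sum_neg_distrib]
        rw [hr, hn]
        ring

lemma frob_wFun : φ e.n (e.wFun x y) = φ e.r y - φ e.r x * φ e.n x +
    φ e.n (e.monom x) * (φ e.n x * φ e.m x - x * φ e.r x - x * φ e.m x + y) := by
  have hn := e.n_eq
  have hm := e.m_le
  have hM := congrArg (φ e.n) (monom_mul_self (e := e) (x := x))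
  rw [map_mul, frob_frob, show e.n + (e.r - e.m) = 2 * e.r by omega] at hM
  have hr := congrArg (φ e.r) h
  unfold FrobeniusEquation at h
  simp only [map_sub, map_mul, map_add, frob_frob] at hr
  rw [show e.r + e.n = e.n + e.r by omega, show e.r + e.r = 2 * e.r by omega, ← hn] at hr
  simp only [wFun, map_sub, map_mul, map_add, frob_frob]
  rw [show e.n + (e.r - e.m) = 2 * e.r by omega]
  linear_combination hr + φ e.n (e.monom x) * h + φ e.r x * hM

lemma frob_zFun : φ e.n (e.zFun x y) =
    φ 1 (φ e.r y - φ e.r x * φ e.n x) -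
      φ e.n (e.monom x) ^ (e.q - 1) * (φ e.r y - φ e.r x * φ e.n x) +
      φ e.n (e.monom x) ^ e.q *
        (-(φ 1 x * φ (e.r + 1) x) + φ 1 y + e.uFun x y + x * φ e.r x - y) := by
  have hu := h.frob_uFun_sub_uFun
  have hw := h.frob_wFun
  have hw' := congrArg (φ 1) hw
  have hM := congrArg (φ e.n) (monom_pow_mul_self (e := e) (x := x))
  have hM' : φ 1 (φ e.n (e.monom x)) = φ e.n (e.monom x) ^ e.q := frob_one _
  rw [map_mul, map_pow, map_pow, ← hM'] at hM
  rw [hFun] at hu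
  rw [← hM', zFun]
  simp only [map_sub, map_mul, map_add, map_pow, e.frob_comm e.n 1, frob_one_frob]
    at hw' hM hu ⊢
  linear_combination hw' + φ (e.n + 1) (e.monom x) * hu -
    φ e.n (e.monom x) ^ (e.q - 1) * hw -
    (φ e.n x * φ e.m x - x * φ e.r x - x * φ e.m x + y) * hM

end FrobeniusEquation

end Functions

section Translation

variable {B : Type*} [CommRing B] [ExpChar B e.p]

local notation "φ" => Exponents.frob e

/-- The translation of `uFun` induced by the translation `y ↦ y + a`. -/
def uShift (a : B) : B := ∑ i ∈ Finset.range e.s, φ (e.r * i) a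

variable {e} {x y a : B}

lemma uFun_add : e.uFun x (y + a) = e.uFun x y + e.uShift a := by
  simp only [uFun, uShift, add_sub_right_comm y a, map_add, Finset.sum_add_distrib]
  ring

lemma wFun_add : e.wFun x (y + a) = e.wFun x y + φ e.r a + a * e.monom x := by
  rw [wFun, wFun, map_add]
  ring

lemma zFun_add_sub_zFun : e.zFun x (y + a) - e.zFun x y =
    φ (e.r + 1) a + e.monom x ^ e.q * (φ 1 a - a + e.uShift a) -
      e.monom x ^ (e.q - 1) * φ e.r a := by
  have hM := monom_pow_mul_self (e := e) (x := x)
  have hM' := frob_one (e := e) (e.monom x)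
  rw [zFun, zFun, wFun_add, uFun_add]
  simp only [map_add, map_mul, frob_one_frob]
  rw [← hM'] at hM ⊢
  linear_combination -a * hM

lemma frob_uShift (ha : φ e.n a = a) :
    φ e.r (e.uShift a) = φ 1 a - a + e.uShift a := by
  have h := e.sum_frob_sub 0 e.r e.s a
  rw [frob_zero, zero_add, e.bezout, ← frob_frob, e.frob_mul_of_frob_eq ha] at h
  simp only [zero_add, map_sub, Finset.sum_sub_distrib, fun i ↦ e.frob_comm i e.r a] at h
  rw [uShift, map_sum]
  linear_combination h

/-- If `u` is invariant under the translation by `a`, then `a` is fixed by the `q`-Frobenius, so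
`s a = 0`, while `n a = 0` since `a` has trace zero; and `r s = 1 + n t`. -/
lemma eq_zero_of_uShift_eq_zero (ha : φ e.n a = a)
    (htr : ∑ i ∈ Finset.range e.n, φ i a = 0) (hu : e.uShift a = 0) : a = 0 := by
  have hφ := frob_uShift ha
  rw [hu, map_zero, add_zero] at hφ
  have hfix (i : ℕ) : φ i a = a := by
    simpa only [one_mul] using e.frob_mul_of_frob_eq (sub_eq_zero.1 hφ.symm) i
  simp only [uShift, hfix, Finset.sum_const, Finset.card_range, nsmul_eq_mul] at hu htr
  have hbezout := congrArg (Nat.cast (R := B)) e.bezout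
  push_cast at hbezout
  linear_combination (-a) * hbezout + (e.r : B) * hu - (e.t : B) * htr

end Translation

end Exponents

lemma valuation_eq_one_of_pow_eq_self {L Γ : Type*} [Field L] [LinearOrderedCommGroupWithZero Γ]
    (v : Valuation L Γ) {a : L} {N : ℕ} (ha : a ≠ 0) (hN : 1 < N) (h : a ^ N = a) : v a = 1 := by
  have hpow : a ^ (N - 1) = 1 := by
    rw [← mul_left_inj' ha, pow_sub_one_mul (by omega), h, one_mul]
  exact (pow_eq_one_iff_of_nonneg (n := N - 1) zero_le (by omega)).1
    (by rw [← map_pow, hpow, map_one])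

namespace Exponents

variable {e : Exponents}

section Subring

variable {B : Type*} [CommRing B] [ExpChar B e.p] {S : Subring B} {x y : B}

local notation "φ" => Exponents.frob e

lemma frob_mem (hx : x ∈ S) (i : ℕ) : φ i x ∈ S := by
  rw [frob_apply]
  exact S.pow_mem hx _

variable (hx : x ∈ S) (hy : y ∈ S)

include hx hy

lemma uFun_mem : e.uFun x y ∈ S :=
  S.add_mem
    (S.sum_mem fun _ _ ↦ frob_mem (S.sub_mem hy (S.mul_mem (frob_mem hx _) hx)) _)
    (S.sum_mem fun _ _ ↦ frob_mem (S.mul_mem (frob_mem hx _) (S.sub_mem (frob_mem hx _) hx)) _)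

lemma wFun_mem : e.wFun x y ∈ S :=
  S.add_mem
    (S.sub_mem (S.sub_mem (frob_mem hy _) (S.mul_mem (frob_mem hx _) (frob_mem hx _)))
      (S.mul_mem (frob_mem hx _) hx))
    (S.mul_mem hy (S.pow_mem hx _))

lemma coprimeFun_mem : e.coprimeFun x y ∈ S := by
  rw [coprimeFun]
  split_ifs
  · exact S.sub_mem
      (S.add_mem (frob_mem (wFun_mem hx hy) _)
        (S.mul_mem (frob_mem (S.pow_mem hx _) _) (uFun_mem hx hy)))
      (S.mul_mem (S.pow_mem (S.pow_mem hx _) _) (wFun_mem hx hy))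
  · exact hy

end Subring

/-- The pole order of `coprimeFun` at infinity. -/
def coprimeOrder (e : Exponents) : ℕ := e.q ^ (2 * e.r) - e.q ^ e.n + e.q ^ e.r + 1

lemma coprime_coprimeOrder (e : Exponents) : (e.q ^ (e.n - 1)).Coprime e.coprimeOrder := by
  obtain ⟨c, hc⟩ : e.q ∣ e.q ^ (2 * e.r) - e.q ^ e.n + e.q ^ e.r :=
    dvd_add (Nat.dvd_sub (dvd_pow_self _ (by have := e.r_pos; omega)) (dvd_pow_self _ e.n_pos.ne'))
      (dvd_pow_self _ e.r_pos.ne')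
  rw [coprimeOrder, hc]
  exact coprime_pow_mul_add_one ..

lemma monom_exponent (e : Exponents) :
    (e.q ^ (e.r - e.m) - 1) * e.q ^ e.n + e.q ^ e.n = e.q ^ (2 * e.r) := by
  have hm := e.m_le
  have hn := e.n_eq
  rw [← Nat.succ_mul, Nat.succ_eq_add_one, Nat.sub_add_cancel (Nat.pow_pos e.q_pos), ← pow_add]
  congr 1
  omega

lemma pow_n_le_monom_exponent (hmr : e.m < e.r) :
    e.q ^ e.n ≤ (e.q ^ (e.r - e.m) - 1) * e.q ^ e.n :=
  Nat.le_mul_of_pos_left _ (Nat.sub_pos_of_lt (Nat.one_lt_pow (by omega) e.two_le_q))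

section Values

variable {L Γ : Type*} [Field L] [LinearOrderedCommGroupWithZero Γ] [ExpChar L e.p]
  {v : Valuation L Γ} {x y : L}

local notation "φ" => Exponents.frob e

lemma valuation_frob (i : ℕ) (a : L) : v (φ i a) = v a ^ e.q ^ i := by
  rw [frob_apply, map_pow]

omit [ExpChar L e.p] in
lemma valuation_monom : v (e.monom x) = v x ^ (e.q ^ (e.r - e.m) - 1) := map_pow ..

lemma valuation_frob_sub_self {i : ℕ} (hx : 1 < v x) (hi : 0 < i) :
    v (φ i x - x) = v x ^ e.q ^ i := by
  rw [Valuation.map_sub_eq_of_lt_left, valuation_frob]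
  rw [valuation_frob]
  exact lt_self_pow₀ hx (Nat.one_lt_pow hi.ne' e.two_le_q)

lemma valuation_pow_of_one_lt_frob_sub {a : L} {i : ℕ} (hi : 0 < i) (ha : 1 < v (φ i a - a)) :
    v a ^ e.q ^ i = v (φ i a - a) := by
  refine (valuation_frob_sub_self ?_ hi).symm
  by_contra! h
  refine ha.not_ge (v.map_sub_le ?_ h)
  rw [valuation_frob]
  exact pow_le_one₀ zero_le h

omit [ExpChar L e.p] in
lemma valuation_pow_pred_of_pow {a : L} {c : ℕ} (h : v a ^ e.q ^ e.n = v x ^ (e.q * c)) :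
    v a ^ e.q ^ (e.n - 1) = v x ^ c := by
  rw [← pow_left_inj₀ zero_le zero_le e.q_pos.ne', ← pow_mul (v a), ← pow_mul (v x), ← pow_succ,
    Nat.sub_add_cancel e.n_pos, h, mul_comm]

lemma valuation_two (hp : Odd e.p) : v 2 = 1 := by
  have h2 : (2 : L) ≠ 0 := by
    have := e.charP L
    rw [← Nat.cast_two, Ne, CharP.cast_eq_zero_iff L e.p, Nat.prime_dvd_prime_iff_eq e.prime
      Nat.prime_two]
    rintro h
    exact absurd (h ▸ hp) (by decide)
  exact valuation_eq_one_of_pow_eq_self v h2 e.prime.one_lt (map_ofNat (frobenius L e.p) 2)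

variable (hx : 1 < v x)

include hx

lemma valuation_frob_add_frob : v (φ e.r x + φ e.m x) = v x ^ e.q ^ e.r := by
  rcases e.m_le.lt_or_eq with hmr | hmr
  · rw [Valuation.map_add_eq_of_lt_left, valuation_frob]
    rw [valuation_frob, valuation_frob]
    exact pow_lt_pow_right₀ hx (Nat.pow_lt_pow_right e.two_le_q hmr)
  · rw [hmr, ← two_mul, map_mul, valuation_two (e.odd_of_eq hmr), one_mul, valuation_frob]

lemma valuation_hFun : v (e.hFun x) = v x ^ (e.q ^ e.m + e.q ^ e.n) := by
  rw [hFun, map_mul, valuation_frob_sub_self hx e.n_pos, valuation_frob, pow_add]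

namespace FrobeniusEquation

variable (h : e.FrobeniusEquation x y)

include h

lemma valuation_y_pow : v y ^ e.q ^ e.n = v x ^ (e.q ^ e.n + e.q ^ e.r) := by
  have hval : v (φ e.n y - y) = v x ^ (e.q ^ e.n + e.q ^ e.r) := by
    rw [h, map_mul, valuation_frob_sub_self hx e.n_pos, valuation_frob_add_frob hx, pow_add]
  rw [← hval]
  refine valuation_pow_of_one_lt_frob_sub e.n_pos ?_
  rw [hval]
  exact one_lt_pow₀ hx (by have := Nat.pow_pos (n := e.n) e.q_pos; omega)

lemma valuation_uFun_pow :
    v (e.uFun x y) ^ e.q ^ e.n = v x ^ (e.q * (e.q ^ e.m + e.q ^ e.n)) := by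
  have hpos : e.q ^ e.m + e.q ^ e.n ≠ 0 := by have := Nat.pow_pos (n := e.m) e.q_pos; omega
  have hlt : v (e.hFun x) < v (φ 1 (e.hFun x)) := by
    rw [valuation_frob, pow_one]
    refine lt_self_pow₀ ?_ e.two_le_q
    rw [valuation_hFun hx]
    exact one_lt_pow₀ hx hpos
  have hval : v (φ e.n (e.uFun x y) - e.uFun x y) =
      v x ^ (e.q * (e.q ^ e.m + e.q ^ e.n)) := by
    rw [h.frob_uFun_sub_uFun, Valuation.map_sub_eq_of_lt_right _ hlt, valuation_frob,
      valuation_hFun hx, ← pow_mul, pow_one, mul_comm]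
  rw [← hval]
  refine valuation_pow_of_one_lt_frob_sub e.n_pos ?_
  rw [hval]
  exact one_lt_pow₀ hx (mul_ne_zero e.q_pos.ne' hpos)

omit [ExpChar L e.p] h in
private lemma le_pow_of_pow_eq {a : L} {b c : ℕ} (ha : v a ^ e.q ^ e.n = v x ^ b)
    (hb : b ≤ c * e.q ^ e.n) : v a ≤ v x ^ c := by
  rw [← pow_le_pow_iff_left₀ zero_le zero_le (Nat.pow_pos e.q_pos).ne', ha, ← pow_mul (v x)]
  exact pow_le_pow_right₀ hx.le hb

lemma valuation_y_le : v y ≤ v x ^ 2 := by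
  refine le_pow_of_pow_eq hx (h.valuation_y_pow hx) ?_
  have := Nat.pow_le_pow_right e.q_pos (show e.r ≤ e.n by have := e.n_eq; omega)
  omega

lemma valuation_uFun_le : v (e.uFun x y) ≤ v x ^ (2 * e.q) := by
  refine le_pow_of_pow_eq hx (h.valuation_uFun_pow hx) ?_
  have := Nat.pow_le_pow_right e.q_pos (show e.m ≤ e.n by have := e.n_eq; omega)
  nlinarith

lemma valuation_frob_y_sub_le :
    v (φ e.r y - φ e.r x * φ e.n x) ≤ v x ^ (e.q ^ e.r + e.q ^ e.n) := by
  have hr := two_mul_pow_le e.two_le_q (show e.r < e.n by have := e.n_eq; have := e.m_pos; omega)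
  refine v.map_sub_le ?_ ?_
  · rw [valuation_frob]
    refine (pow_le_pow_left₀ zero_le (h.valuation_y_le hx) _).trans ?_
    rw [← pow_mul]
    exact pow_le_pow_right₀ hx.le (by omega)
  · rw [map_mul, valuation_frob, valuation_frob, pow_add]

lemma valuation_frob_wFun_bracket :
    v (φ e.n x * φ e.m x - x * φ e.r x - x * φ e.m x + y) = v x ^ (e.q ^ e.n + e.q ^ e.m) := by
  have hr := two_mul_pow_le e.two_le_q (show e.r < e.n by have := e.n_eq; have := e.m_pos; omega)
  have hm := two_mul_pow_le e.two_le_q e.m_pos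
  have hmr := Nat.pow_le_pow_right e.q_pos e.m_le
  rw [pow_zero] at hm
  have hrest : v (x * φ e.r x + x * φ e.m x - y) ≤ v x ^ (1 + e.q ^ e.r) := by
    refine v.map_sub_le (v.map_add_le ?_ ?_) ((h.valuation_y_le hx).trans ?_)
    · rw [map_mul, valuation_frob, pow_add, pow_one]
    · rw [map_mul, valuation_frob, ← pow_succ']
      exact pow_le_pow_right₀ hx.le (by omega)
    · exact pow_le_pow_right₀ hx.le (by omega)
  have hlead : v (φ e.n x * φ e.m x) = v x ^ (e.q ^ e.n + e.q ^ e.m) := by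
    rw [map_mul, valuation_frob, valuation_frob, pow_add]
  have hsplit : φ e.n x * φ e.m x - x * φ e.r x - x * φ e.m x + y =
      φ e.n x * φ e.m x - (x * φ e.r x + x * φ e.m x - y) := by ring
  rw [hsplit, Valuation.map_sub_eq_of_lt_left, hlead]
  rw [hlead]
  exact hrest.trans_lt (pow_lt_pow_right₀ hx (by omega))

lemma valuation_wFun_pow (hmr : e.m < e.r) :
    v (e.wFun x y) ^ e.q ^ e.n = v x ^ (e.q ^ (2 * e.r) + e.q ^ e.m) := by
  have hr := two_mul_pow_le e.two_le_q (show e.r < e.n by have := e.n_eq; have := e.m_pos; omega)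
  have hG := pow_n_le_monom_exponent hmr
  have hlead : v (φ e.n (e.monom x) *
      (φ e.n x * φ e.m x - x * φ e.r x - x * φ e.m x + y)) =
      v x ^ (e.q ^ (2 * e.r) + e.q ^ e.m) := by
    rw [map_mul, valuation_frob, valuation_monom, h.valuation_frob_wFun_bracket hx, ← pow_mul,
      ← pow_add, ← add_assoc, e.monom_exponent]
  rw [← valuation_frob, h.frob_wFun, Valuation.map_add_eq_of_lt_right, hlead]
  rw [hlead]
  refine (h.valuation_frob_y_sub_le hx).trans_lt (pow_lt_pow_right₀ hx ?_)
  have := e.monom_exponent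
  have := Nat.pow_pos (n := e.m) e.q_pos
  omega

lemma valuation_frob_zFun_bracket :
    v (-(φ 1 x * φ (e.r + 1) x) + φ 1 y + e.uFun x y + x * φ e.r x - y) =
      v x ^ (e.q + e.q ^ (e.r + 1)) := by
  have hq := e.two_le_q
  have hr := two_mul_pow_le hq e.r_pos
  have hr' := two_mul_pow_le hq (show 1 < e.r + 1 by have := e.r_pos; omega)
  have hrr := two_mul_pow_le hq (show e.r < e.r + 1 by omega)
  rw [pow_zero] at hr
  rw [pow_one] at hr'
  have hrest : v (φ 1 y + e.uFun x y + x * φ e.r x - y) ≤ v x ^ e.q ^ (e.r + 1) := by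
    refine v.map_sub_le (v.map_add_le (v.map_add_le ?_ ?_) ?_) ?_
    · rw [valuation_frob, pow_one]
      refine (pow_le_pow_left₀ zero_le (h.valuation_y_le hx) _).trans ?_
      rw [← pow_mul]
      exact pow_le_pow_right₀ hx.le hr'
    · exact (h.valuation_uFun_le hx).trans (pow_le_pow_right₀ hx.le hr')
    · rw [map_mul, valuation_frob, ← pow_succ']
      exact pow_le_pow_right₀ hx.le (by omega)
    · exact (h.valuation_y_le hx).trans (pow_le_pow_right₀ hx.le (by omega))
  have hlead : v (φ 1 x * φ (e.r + 1) x) = v x ^ (e.q + e.q ^ (e.r + 1)) := by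
    rw [map_mul, valuation_frob, valuation_frob, pow_one, pow_add (v x)]
  have hsplit : -(φ 1 x * φ (e.r + 1) x) + φ 1 y + e.uFun x y + x * φ e.r x - y =
      φ 1 y + e.uFun x y + x * φ e.r x - y - φ 1 x * φ (e.r + 1) x := by ring
  rw [hsplit, Valuation.map_sub_eq_of_lt_right, hlead]
  rw [hlead]
  exact hrest.trans_lt (pow_lt_pow_right₀ hx (by omega))

lemma valuation_zFun_pow (hmr : e.m < e.r) : v (e.zFun x y) ^ e.q ^ e.n =
    v x ^ (e.q * e.coprimeOrder) := by
  have hG := pow_n_le_monom_exponent hmr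
  have hr := pow_succ' e.q e.r
  rw [coprimeOrder, ← e.monom_exponent, Nat.add_sub_cancel, ← valuation_frob, h.frob_zFun]
  have hM : v (φ e.n (e.monom x)) = v x ^ ((e.q ^ (e.r - e.m) - 1) * e.q ^ e.n) := by
    rw [valuation_frob, valuation_monom, ← pow_mul]
  have hA := h.valuation_frob_y_sub_le hx
  set A := φ e.r y - φ e.r x * φ e.n x
  generalize (e.q ^ (e.r - e.m) - 1) * e.q ^ e.n = G at hG hM ⊢
  have hlead : v (φ e.n (e.monom x) ^ e.q *
      (-(φ 1 x * φ (e.r + 1) x) + φ 1 y + e.uFun x y + x * φ e.r x - y)) =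
      v x ^ (e.q * (G + e.q ^ e.r + 1)) := by
    rw [map_mul, map_pow, hM, h.valuation_frob_zFun_bracket hx, ← pow_mul, ← pow_add, hr]
    congr 1
    ring
  have hA1 : v (φ 1 A) < v x ^ (e.q * (G + e.q ^ e.r + 1)) := by
    rw [valuation_frob, pow_one]
    refine (pow_le_pow_left₀ zero_le hA _).trans_lt ?_
    rw [← pow_mul, mul_comm]
    exact pow_lt_pow_right₀ hx (Nat.mul_lt_mul_of_pos_left (by omega) e.q_pos)
  have hA2 : v (φ e.n (e.monom x) ^ (e.q - 1) * A) < v x ^ (e.q * (G + e.q ^ e.r + 1)) := by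
    rw [map_mul, map_pow, hM, ← pow_mul]
    refine (mul_le_mul_right hA _).trans_lt ?_
    rw [← pow_add]
    refine pow_lt_pow_right₀ hx ?_
    obtain ⟨c, hc⟩ := Nat.exists_eq_succ_of_ne_zero e.q_pos.ne'
    generalize e.q ^ e.r = R, e.q ^ e.n = N at *
    rw [hc, Nat.succ_sub_one]
    nlinarith [Nat.zero_le (c * R)]
  rw [Valuation.map_add_eq_of_lt_right, hlead]
  rw [hlead]
  exact v.map_sub_lt hA1 hA2

lemma valuation_coprimeFun_pow :
    v (e.coprimeFun x y) ^ e.q ^ (e.n - 1) = v x ^ e.coprimeOrder := by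
  refine valuation_pow_pred_of_pow ?_
  rw [coprimeFun]
  split_ifs with hmr
  · exact h.valuation_zFun_pow hx hmr
  · have hmr' : e.m = e.r := by have := e.m_le; omega
    have hr := e.r_eq_one_of_eq hmr'
    rw [coprimeOrder, h.valuation_y_pow hx, show e.n = 2 by have := e.n_eq; omega, hr,
      mul_one, Nat.sub_self, pow_one]
    congr 1
    ring

end FrobeniusEquation

lemma valuation_coprimeFun_add_sub {a : L} (ha : a ≠ 0) (hfix : φ e.n a = a)
    (htr : ∑ i ∈ Finset.range e.n, φ i a = 0) :
    v (e.coprimeFun x (y + a) - e.coprimeFun x y) =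
      v x ^ (e.q * (e.q ^ (e.r - e.m) - 1)) := by
  have hone {b : L} (hb : b ≠ 0) (hbfix : φ e.n b = b) : v b = 1 :=
    valuation_eq_one_of_pow_eq_self v hb (Nat.one_lt_pow e.n_pos.ne' e.two_le_q)
      (by rwa [frob_apply] at hbfix)
  have hfrob (i : ℕ) : v (φ i a) = 1 := by rw [valuation_frob, hone ha hfix, one_pow]
  simp only [coprimeFun]
  split_ifs with hmr
  · have hbracket : v (φ 1 a - a + e.uShift a) = 1 := by
      have hne : e.uShift a ≠ 0 := fun h0 ↦ ha (eq_zero_of_uShift_eq_zero hfix htr h0)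
      rw [← frob_uShift hfix, valuation_frob, hone hne, one_pow]
      simp only [uShift, map_sum, e.frob_comm e.n, hfix]
    have hd : 0 < e.q ^ (e.r - e.m) - 1 :=
      Nat.sub_pos_of_lt (Nat.one_lt_pow (by omega) e.two_le_q)
    have hlead : v (e.monom x ^ e.q * (φ 1 a - a + e.uShift a)) =
        v x ^ (e.q * (e.q ^ (e.r - e.m) - 1)) := by
      rw [map_mul, hbracket, mul_one, map_pow, valuation_monom, ← pow_mul, mul_comm]
    have hfirst : v (φ (e.r + 1) a) < v (e.monom x ^ e.q * (φ 1 a - a + e.uShift a)) := by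
      rw [hlead, hfrob]
      exact one_lt_pow₀ hx (mul_ne_zero e.q_pos.ne' hd.ne')
    have hlast : v (e.monom x ^ (e.q - 1) * φ e.r a) <
        v (e.monom x ^ e.q * (φ 1 a - a + e.uShift a)) := by
      rw [hlead, map_mul, hfrob, mul_one, map_pow, valuation_monom, ← pow_mul, mul_comm]
      exact pow_lt_pow_right₀ hx (Nat.mul_lt_mul_of_pos_right (Nat.sub_one_lt e.q_pos.ne') hd)
    have hsum := Valuation.map_add_eq_of_lt_right v hfirst
    rw [zFun_add_sub_zFun, Valuation.map_sub_eq_of_lt_left _ (hsum ▸ hlast), hsum, hlead]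
  · rw [add_sub_cancel_left, hone ha hfix, Nat.sub_eq_zero_of_le (not_lt.1 hmr), pow_zero,
      Nat.sub_self, mul_zero, pow_zero]

end Values

end Exponents

section TracePoly

variable {R : Type*} [CommRing R] {q n : ℕ}

lemma degree_tracePoly_lt [Nontrivial R] (hq : 2 ≤ q) :
    (tracePoly R q n).degree < (q ^ n : ℕ) := by
  refine (degree_sum_le _ _).trans_lt ((Finset.sup_lt_iff (WithBot.bot_lt_coe _)).2 ?_)
  intro i hi
  rw [degree_X_pow]
  exact_mod_cast Nat.pow_lt_pow_right hq (Finset.mem_range.1 hi)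

lemma tracePoly_eq_X_pow_add (hn : 0 < n) :
    tracePoly R q n = X ^ q ^ (n - 1) + tracePoly R q (n - 1) := by
  obtain ⟨n, rfl⟩ := Nat.exists_eq_succ_of_ne_zero hn.ne'
  rw [tracePoly, Finset.sum_range_succ, add_comm, Nat.succ_sub_one, tracePoly]

variable [Nontrivial R]

lemma tracePoly_monic (hq : 2 ≤ q) (hn : 0 < n) : (tracePoly R q n).Monic := by
  rw [tracePoly_eq_X_pow_add hn]
  exact monic_X_pow_add (degree_tracePoly_lt hq)

lemma degree_tracePoly (hq : 2 ≤ q) (hn : 0 < n) :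
    (tracePoly R q n).degree = (q ^ (n - 1) : ℕ) := by
  rw [tracePoly_eq_X_pow_add hn, degree_add_eq_left_of_degree_lt, degree_X_pow]
  rw [degree_X_pow]
  exact degree_tracePoly_lt hq

omit [Nontrivial R] in
lemma derivative_tracePoly (hq : (q : R) = 0) (hn : 0 < n) :
    derivative (tracePoly R q n) = 1 := by
  obtain ⟨n, rfl⟩ := Nat.exists_eq_succ_of_ne_zero hn.ne'
  rw [tracePoly, derivative_sum, Finset.sum_range_succ', Finset.sum_eq_zero, zero_add, pow_zero,
    pow_one, derivative_X]
  intro i _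
  rw [derivative_X_pow, pow_succ, Nat.cast_mul, hq, mul_zero, map_zero, zero_mul]

end TracePoly

section CurvePoly

variable {K : Type*} [Field K] {q n r : ℕ}

lemma degree_C_lt_degree_tracePoly (hq : 2 ≤ q) (hn : 0 < n) (f : K[X]) :
    (C f : K[X][X]).degree < (tracePoly K[X] q n).degree := by
  rw [degree_tracePoly hq hn]
  refine degree_C_le.trans_lt ?_
  exact_mod_cast Nat.pow_pos (by omega)

lemma curvePoly_monic (hq : 2 ≤ q) (hn : 0 < n) : (curvePoly K q n r).Monic :=
  (tracePoly_monic hq hn).sub_of_left (degree_C_lt_degree_tracePoly hq hn _)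

lemma natDegree_curvePoly (hq : 2 ≤ q) (hn : 0 < n) :
    (curvePoly K q n r).natDegree = q ^ (n - 1) :=
  natDegree_sub_C.trans (natDegree_eq_of_degree_eq_some (degree_tracePoly hq hn))

lemma derivative_curvePoly (hq : (q : K) = 0) (hn : 0 < n) :
    derivative (curvePoly K q n r) = 1 := by
  have hq' : (q : K[X]) = 0 := by rw [← map_natCast (C : K →+* K[X]), hq, map_zero]
  rw [curvePoly, derivative_sub, derivative_C, sub_zero, derivative_tracePoly hq' hn]

end CurvePoly

namespace Exponents

variable {e : Exponents} {K : Type*} [Field K] [ExpChar K e.p]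

local notation "φ" => Exponents.frob e

lemma frob_X_mul_frob_X (i j : ℕ) :
    φ i (X * φ j (X : K[X])) = X ^ (e.q ^ i + e.q ^ (i + j)) := by
  rw [map_mul, frob_frob, frob_apply, frob_apply, ← pow_add]

lemma degree_frob_X_mul_frob_X_lt {i j : ℕ} (hj : 0 < j) (hij : i + j < e.n) :
    (φ i (X * φ j (X : K[X]))).degree < ((e.q ^ e.n : ℕ) : WithBot ℕ) := by
  have h1 := two_mul_pow_le e.two_le_q hij
  have h2 := two_mul_pow_le e.two_le_q (show i < i + j by omega)
  have h3 : 0 < e.q ^ i := Nat.pow_pos e.q_pos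
  rw [frob_X_mul_frob_X, degree_X_pow]
  exact_mod_cast (by omega : e.q ^ i + e.q ^ (i + j) < e.q ^ e.n)

lemma tracePoly_comp_eq : (tracePoly K e.q e.n).comp (X ^ (1 + e.q ^ e.r)) =
    ∑ i ∈ Finset.range e.m, φ i (X * φ e.r X) +
      ∑ i ∈ Finset.range e.r, φ (e.m + i) (X * φ e.r X) := by
  rw [← Finset.sum_range_add, ← add_comm e.r, ← e.n_eq, tracePoly, Polynomial.sum_comp]
  refine Finset.sum_congr rfl fun i _ ↦ ?_
  rw [frob_X_mul_frob_X, X_pow_comp, ← pow_mul, add_mul, one_mul, ← pow_add, add_comm e.r]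

/-- The exponents `q ^ (m + i) + q ^ (n + i)` of `T_n(x ^ (1 + q ^ r))` are reduced to
`q ^ (m + i) + q ^ i` by subtracting a multiple of `(x ^ q ^ n - x) ^ q ^ i`. -/
theorem fPoly_eq : fPoly K e.q e.n e.r = ∑ i ∈ Finset.range e.m, φ i (X * φ e.r X) +
    ∑ i ∈ Finset.range e.r, φ i (X * φ e.m X) := by
  have hn := e.n_eq
  have hone : 1 < e.q ^ e.n := Nat.one_lt_pow e.n_pos.ne' e.two_le_q
  have hlt : (X : K[X]).degree < (X ^ e.q ^ e.n : K[X]).degree := by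
    rw [degree_X, degree_X_pow]
    exact_mod_cast hone
  have hmonic : (X ^ e.q ^ e.n - X : K[X]).Monic := (monic_X_pow _).sub_of_left hlt
  rw [fPoly, ← modByMonic_eq_mod _ hmonic]
  refine (div_modByMonic_unique
    (∑ i ∈ Finset.range e.r, φ (e.m + i) X * (X ^ e.q ^ e.n - X) ^ (e.q ^ i - 1)) _
    hmonic ⟨?_, ?_⟩).2
  · have hterm (i : ℕ) : (X ^ e.q ^ e.n - X : K[X]) *
        (φ (e.m + i) X * (X ^ e.q ^ e.n - X) ^ (e.q ^ i - 1)) =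
        φ (e.m + i) X * φ i (X ^ e.q ^ e.n - X) := by
      rw [e.frob_apply i, mul_left_comm, mul_pow_sub_one (Nat.pow_pos e.q_pos).ne']
    rw [tracePoly_comp_eq, add_assoc, Finset.mul_sum, ← Finset.sum_add_distrib]
    congr 1
    refine Finset.sum_congr rfl fun i _ ↦ ?_
    rw [hterm, ← e.frob_apply e.n X, map_sub, map_mul, map_mul, frob_frob, frob_frob, frob_frob,
      show e.m + i + e.r = i + e.n by omega, add_comm i e.m]
    ring
  · rw [degree_sub_eq_left_of_degree_lt hlt, degree_X_pow]
    have hsum {a b : ℕ} (hb : 0 < b) (hab : a + b = e.n) :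
        (∑ i ∈ Finset.range a, φ i (X * φ b (X : K[X]))).degree < ((e.q ^ e.n : ℕ) : WithBot ℕ) :=
      (degree_sum_le _ _).trans_lt <| (Finset.sup_lt_iff (WithBot.bot_lt_coe _)).2 fun i hi ↦
        degree_frob_X_mul_frob_X_lt hb (by have := Finset.mem_range.1 hi; omega)
    exact (degree_add_le _ _).trans_lt
      (max_lt (hsum e.r_pos (by omega)) (hsum e.m_pos (by omega)))

theorem frobeniusEquation_of_sum_eq {B : Type*} [CommRing B] [Algebra K B] [ExpChar B e.p]
    {x y : B} (hxy : ∑ i ∈ Finset.range e.n, y ^ e.q ^ i = aeval x (fPoly K e.q e.n e.r)) :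
    e.FrobeniusEquation x y := by
  have hmap := e.map_frob (aeval x : K[X] →ₐ[K] B).toRingHom
  simp only [AlgHom.toRingHom_eq_coe, RingHom.coe_coe] at hmap
  simp only [← e.frob_apply, fPoly_eq, map_add, map_sum, hmap, map_mul, aeval_X] at hxy
  simp only [← map_mul] at hxy
  rw [FrobeniusEquation, ← frob_sum_sub_sum, hxy, map_add, add_sub_add_comm, frob_sum_sub_sum,
    frob_sum_sub_sum, map_mul, map_mul, frob_frob, frob_frob, ← e.n_eq, add_comm e.m, ← e.n_eq]
  ring

lemma frob_n_eq_self [Finite K] (hK : Nat.card K = e.q ^ e.n) (a : K) : φ e.n a = a := by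
  have := Fintype.ofFinite K
  rw [frob_apply, ← hK, Nat.card_eq_fintype_card, FiniteField.pow_card]

open scoped Classical in
/-- The elements of trace zero, as the roots of `T_n`. -/
def traceZero (e : Exponents) (K : Type*) [Field K] : Finset K :=
  (tracePoly K e.q e.n).roots.toFinset

lemma mem_traceZero {a : K} : a ∈ e.traceZero K ↔ ∑ i ∈ Finset.range e.n, φ i a = 0 := by
  classical
  rw [traceZero, Multiset.mem_toFinset, mem_roots (tracePoly_monic e.two_le_q e.n_pos).ne_zero,
    IsRoot, tracePoly, eval_finsetSum]
  simp only [eval_pow, eval_X, frob_apply]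

/-- `T_n` divides `T_n ^ q - T_n = X ^ q ^ n - X`, which has `q ^ n` roots. -/
lemma card_traceZero [Finite K] (hK : Nat.card K = e.q ^ e.n) :
    (e.traceZero K).card = e.q ^ (e.n - 1) := by
  classical
  have := Fintype.ofFinite K
  rw [Nat.card_eq_fintype_card] at hK
  have hne : (X ^ Fintype.card K - X : K[X]) ≠ 0 :=
    FiniteField.X_pow_card_sub_X_ne_zero K Fintype.one_lt_card
  have hsplits : (X ^ Fintype.card K - X : K[X]).Splits := by
    rw [splits_iff_card_roots, FiniteField.roots_X_pow_card_sub_X,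
      FiniteField.X_pow_card_sub_X_natDegree_eq K Fintype.one_lt_card]
    rfl
  have hdvd : tracePoly K e.q e.n ∣ X ^ Fintype.card K - X := by
    have h := e.frob_sum_sub_sum e.n (X : K[X])
    simp only [e.frob_apply _ (X : K[X]), ← hK] at h
    rw [← h, frob_one]
    exact dvd_sub (dvd_pow_self _ e.q_pos.ne') dvd_rfl
  have hnodup : (tracePoly K e.q e.n).roots.Nodup :=
    Multiset.nodup_of_le (roots.le_of_dvd hne hdvd) <| by
      rw [FiniteField.roots_X_pow_card_sub_X]
      exact Finset.univ.nodup
  rw [traceZero, Multiset.toFinset_card_of_nodup hnodup,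
    ← (hsplits.of_dvd hne hdvd).natDegree_eq_card_roots]
  exact natDegree_eq_of_degree_eq_some (degree_tracePoly e.two_le_q e.n_pos)

end Exponents

namespace Exponents

section CurveRat

variable (e : Exponents) (K : Type*) [Field K]

/-- The equation `T_n(y) - f_r(x)` of the curve over the rational function field `K(x)`. -/
abbrev curveRat : (RatFunc K)[X] :=
  (curvePoly K e.q e.n e.r).map (algebraMap K[X] (RatFunc K))

lemma curveRat_monic : (e.curveRat K).Monic :=
  (curvePoly_monic e.two_le_q e.n_pos).map _

lemma natDegree_curveRat : (e.curveRat K).natDegree = e.q ^ (e.n - 1) :=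
  ((curvePoly_monic e.two_le_q e.n_pos).natDegree_map _).trans
    (natDegree_curvePoly e.two_le_q e.n_pos)

lemma separable_curveRat [ExpChar K e.p] : (e.curveRat K).Separable := by
  have := e.charP K
  have hq : (e.q : K) = 0 := by
    rw [q, Nat.cast_pow, CharP.cast_eq_zero, zero_pow e.k_pos.ne']
  rw [Polynomial.Separable, curveRat, derivative_map, derivative_curvePoly hq e.n_pos,
    Polynomial.map_one]
  exact isCoprime_one_right

variable {K} in
lemma aeval_curveRat {L : Type*} [Field L] [Algebra K L] [Algebra (RatFunc K) L]
    [IsScalarTower K (RatFunc K) L] (y : L) : aeval y (e.curveRat K) =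
      ∑ i ∈ Finset.range e.n, y ^ e.q ^ i - aeval (ratX K L) (fPoly K e.q e.n e.r) := by
  rw [curveRat, curvePoly, tracePoly, Polynomial.map_sub, Polynomial.map_sum, map_sub, map_sum,
    map_C, aeval_C, ratX, aeval_algebraMap_apply, ← RatFunc.algebraMap_X, aeval_algebraMap_apply,
    aeval_X_left_apply]
  simp only [Polynomial.map_pow, Polynomial.map_X, map_pow, aeval_X]

end CurveRat

/-- The field `L` is generated over `K(x)` by a root `y` of the equation of the curve. The equation
is not assumed to be irreducible: this is deduced from the ramification of `L` at infinity. -/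
structure IsCurveGenerator (e : Exponents) (K : Type*) {L : Type*} [Field K] [Field L]
    [Algebra (RatFunc K) L] (y : L) : Prop where
  aeval_eq_zero : aeval y (e.curveRat K) = 0
  adjoin_eq_top : IntermediateField.adjoin (RatFunc K) {y} = ⊤

namespace IsCurveGenerator

section Algebraic

variable {e : Exponents} {K L : Type*} [Field K] [Field L] [Algebra (RatFunc K) L] {y : L}
  (hy : e.IsCurveGenerator K y)

include hy

lemma isIntegral : IsIntegral (RatFunc K) y :=
  ⟨e.curveRat K, e.curveRat_monic K, hy.aeval_eq_zero⟩

lemma exists_powerBasis : ∃ pb : PowerBasis (RatFunc K) L, pb.gen = y :=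
  exists_powerBasis_gen_eq hy.isIntegral hy.adjoin_eq_top

lemma finiteDimensional : FiniteDimensional (RatFunc K) L := by
  obtain ⟨pb, -⟩ := hy.exists_powerBasis
  exact pb.finite

lemma finrank_eq_natDegree_minpoly :
    Module.finrank (RatFunc K) L = (minpoly (RatFunc K) y).natDegree := by
  obtain ⟨pb, rfl⟩ := hy.exists_powerBasis
  rw [pb.finrank, pb.natDegree_minpoly]

lemma finrank_le : Module.finrank (RatFunc K) L ≤ e.q ^ (e.n - 1) := by
  rw [hy.finrank_eq_natDegree_minpoly, ← e.natDegree_curveRat K]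
  exact natDegree_le_of_dvd (minpoly.dvd _ _ hy.aeval_eq_zero) (e.curveRat_monic K).ne_zero

lemma isSeparable [ExpChar K e.p] : Algebra.IsSeparable (RatFunc K) L := by
  have hsep : IsSeparable (RatFunc K) y :=
    (e.separable_curveRat K).of_dvd (minpoly.dvd _ _ hy.aeval_eq_zero)
  have := (IntermediateField.isSeparable_adjoin_simple_iff_isSeparable (RatFunc K) L).2 hsep
  rw [hy.adjoin_eq_top] at this
  exact AlgEquiv.Algebra.isSeparable IntermediateField.topEquiv

end Algebraic

variable {e : Exponents} {K L : Type*} [Field K] [Field L] [Algebra K L] [Algebra (RatFunc K) L]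
  [IsScalarTower K (RatFunc K) L] [ExpChar K e.p] [ExpChar L e.p] {y : L}
  (hy : e.IsCurveGenerator K y)

local notation "φ" => Exponents.frob e

include hy

lemma frobeniusEquation : e.FrobeniusEquation (ratX K L) y :=
  frobeniusEquation_of_sum_eq (sub_eq_zero.1 ((e.aeval_curveRat y).symm.trans hy.aeval_eq_zero))

theorem isTotallyRamified (P : Place K L) (hx : 1 < P.v (ratX K L)) :
    P.IsTotallyRamified (e.q ^ (e.n - 1)) e.coprimeOrder (e.coprimeFun (ratX K L) y) := by
  have := hy.finiteDimensional
  exact P.isTotallyRamified (Nat.pow_pos e.q_pos) e.coprime_coprimeOrder hy.finrank_le hx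
    (hy.frobeniusEquation.valuation_coprimeFun_pow hx)

theorem existsUnique_place : ∃! P : Place K L, 1 < P.v (ratX K L) := by
  have := hy.finiteDimensional
  have := hy.isSeparable
  obtain ⟨P, hP⟩ := exists_place_one_lt K L
  exact ⟨P, hP, fun Q hQ ↦ (hy.isTotallyRamified Q hQ).eq (hy.isTotallyRamified P hP)⟩

lemma finrank_eq : Module.finrank (RatFunc K) L = e.q ^ (e.n - 1) := by
  obtain ⟨P, hP, -⟩ := hy.existsUnique_place
  exact (hy.isTotallyRamified P hP).finrank_eq

lemma minpoly_eq : minpoly (RatFunc K) y = e.curveRat K := by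
  refine (eq_of_monic_of_dvd_of_natDegree_le (minpoly.monic hy.isIntegral) (e.curveRat_monic K)
    (minpoly.dvd _ _ hy.aeval_eq_zero) ?_).symm
  rw [e.natDegree_curveRat, ← hy.finrank_eq_natDegree_minpoly, hy.finrank_eq]

end IsCurveGenerator

lemma isCurveGenerator_root {e : Exponents} {K : Type*} [Field K] {g : (RatFunc K)[X]}
    [Fact (Irreducible g)] (hg : g ∣ e.curveRat K) :
    e.IsCurveGenerator K (AdjoinRoot.root g) where
  aeval_eq_zero := by rwa [AdjoinRoot.aeval_eq, AdjoinRoot.mk_eq_zero]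
  adjoin_eq_top := by
    rw [← IntermediateField.adjoin_eq_top_of_algebra]
    exact AdjoinRoot.adjoinRoot_eq_top

/-- A root of any irreducible factor generates an extension of degree `q ^ (n - 1)`. -/
theorem irreducible_curveRat (e : Exponents) (K : Type*) [Field K] [ExpChar K e.p] :
    Irreducible (e.curveRat K) := by
  have hne := (e.curveRat_monic K).ne_zero
  have hnu : ¬ IsUnit (e.curveRat K) := fun h ↦
    (Nat.pow_pos (n := e.n - 1) e.q_pos).ne'
      ((e.natDegree_curveRat K).symm.trans (natDegree_eq_zero_of_isUnit h))
  obtain ⟨g, hg, hdvd⟩ := WfDvdMonoid.exists_irreducible_factor hnu hne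
  have : Fact (Irreducible g) := ⟨hg⟩
  have : ExpChar (AdjoinRoot g) e.p :=
    expChar_of_injective_algebraMap (algebraMap K (AdjoinRoot g)).injective e.p
  have hdeg : g.natDegree = e.q ^ (e.n - 1) := by
    rw [← (isCurveGenerator_root hdvd).finrank_eq, (AdjoinRoot.powerBasis hg.ne_zero).finrank,
      AdjoinRoot.powerBasis_dim]
  exact (associated_of_dvd_of_natDegree_le hdvd hne
    ((e.natDegree_curveRat K).trans hdeg.symm).le).irreducible hg

theorem isDomain_coordinateRing (e : Exponents) (K : Type*) [Field K] [ExpChar K e.p] :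
    IsDomain (CoordinateRing K e.q e.n e.r) := by
  have hirr : Irreducible (curvePoly K e.q e.n e.r) :=
    ((curvePoly_monic e.two_le_q e.n_pos).irreducible_iff_irreducible_map_fraction_map
      (K := RatFunc K)).2 (e.irreducible_curveRat K)
  exact AdjoinRoot.isDomain_of_prime hirr.prime

namespace IsCurveGenerator

variable {e : Exponents} {K L : Type*} [Field K] [Field L] [Algebra K L] [Algebra (RatFunc K) L]
  [IsScalarTower K (RatFunc K) L] [ExpChar K e.p] [ExpChar L e.p] {y : L}
  (hy : e.IsCurveGenerator K y)

local notation "φ" => Exponents.frob e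

include hy

lemma exists_algHom_eq_add {a : K} (ha : a ∈ e.traceZero K) :
    ∃ f : L →ₐ[RatFunc K] L, f y = y + algebraMap K L a := by
  obtain ⟨pb, rfl⟩ := hy.exists_powerBasis
  have hroot : aeval (pb.gen + algebraMap K L a) (minpoly (RatFunc K) pb.gen) = 0 := by
    have heq := hy.aeval_eq_zero
    rw [aeval_curveRat] at heq
    rw [hy.minpoly_eq, aeval_curveRat]
    simp only [← e.frob_apply, map_add, Finset.sum_add_distrib, ← e.map_frob (algebraMap K L)]
      at heq ⊢
    rw [← map_sum, mem_traceZero.1 ha, map_zero, add_zero, heq]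
  exact ⟨pb.lift _ hroot, pb.lift_gen _ hroot⟩

variable [Finite K] (hK : Nat.card K = e.q ^ e.n) {P : Place K L} (hx : 1 < P.v (ratX K L))

include hK hx

lemma valuation_coprimeFun_add_sub {a b : K} (ha : a ∈ e.traceZero K) (hb : b ∈ e.traceZero K)
    (hab : a ≠ b) :
    P.v (e.coprimeFun (ratX K L) (y + algebraMap K L a) -
        e.coprimeFun (ratX K L) (y + algebraMap K L b)) =
      exp ((e.q ^ (2 * e.r) - e.q ^ e.n : ℕ) : ℤ) := by
  have hn := e.n_eq
  have hm := e.m_le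
  have hmap := e.map_frob (algebraMap K L)
  have htr : ∑ i ∈ Finset.range e.n, φ i (algebraMap K L (a - b)) = 0 := by
    simp only [← hmap, ← map_sum, map_sub, Finset.sum_sub_distrib]
    rw [mem_traceZero.1 ha, mem_traceZero.1 hb, sub_self]
  have h := Exponents.valuation_coprimeFun_add_sub hx (y := y + algebraMap K L b)
    ((_root_.map_ne_zero _).2 (sub_ne_zero.2 hab)) (by rw [← hmap, frob_n_eq_self hK]) htr
  rw [map_sub (algebraMap K L), add_assoc, add_sub_cancel] at h
  rw [h, (hy.isTotallyRamified P hx).valuation_ratX, ← exp_nsmul, nsmul_eq_mul, ← Nat.cast_mul,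
    mul_right_comm, ← pow_succ', Nat.sub_add_cancel e.n_pos, Nat.mul_sub_one, ← pow_add,
    show e.n + (e.r - e.m) = 2 * e.r by omega]

theorem map_minpoly_coprimeFun :
    (minpoly (RatFunc K) (e.coprimeFun (ratX K L) y)).map (algebraMap (RatFunc K) L) =
      Lagrange.nodal (e.traceZero K)
        fun a ↦ e.coprimeFun (ratX K L) (y + algebraMap K L a) := by
  classical
  have := hy.finiteDimensional
  set z : K → L := fun a ↦ e.coprimeFun (ratX K L) (y + algebraMap K L a)
  set M := minpoly (RatFunc K) (e.coprimeFun (ratX K L) y)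
  have hroot (a : K) (ha : a ∈ e.traceZero K) :
      (M.map (algebraMap (RatFunc K) L)).IsRoot (z a) := by
    obtain ⟨f, hf⟩ := hy.exists_algHom_eq_add ha
    have hz : f (e.coprimeFun (ratX K L) y) = z a := by
      have hmap := e.map_coprimeFun (f : L →+* L) (ratX K L) y
      rwa [RingHom.coe_coe, hf, ratX, f.commutes] at hmap
    rw [IsRoot, eval_map_algebraMap, ← hz, aeval_algHom_apply, minpoly.aeval, map_zero]
  have hdvd : Lagrange.nodal (e.traceZero K) z ∣ M.map (algebraMap (RatFunc K) L) := by
    refine Finset.prod_dvd_of_coprime (fun a ha b hb hab ↦ ?_) fun a ha ↦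
      dvd_iff_isRoot.2 (hroot a ha)
    have hne : P.v (z a - z b) ≠ 0 := by
      rw [hy.valuation_coprimeFun_add_sub hK hx ha hb hab]
      exact exp_ne_zero
    exact isCoprime_X_sub_C_of_isUnit_sub (IsUnit.mk0 _ (P.v.ne_zero_iff.1 hne))
  refine eq_of_monic_of_dvd_of_natDegree_le Lagrange.nodal_monic
    ((minpoly.monic (Algebra.IsIntegral.isIntegral _)).map _) hdvd ?_
  rw [natDegree_map, (hy.isTotallyRamified P hx).natDegree_minpoly, Lagrange.natDegree_nodal,
    card_traceZero hK]

theorem valuation_derivative_minpoly_coprimeFun :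
    P.v (aeval (e.coprimeFun (ratX K L) y)
      (derivative (minpoly (RatFunc K) (e.coprimeFun (ratX K L) y)))) =
    exp (((e.q ^ (e.n - 1) - 1) * (e.q ^ (2 * e.r) - e.q ^ e.n) : ℕ) : ℤ) := by
  classical
  have h0 : (0 : K) ∈ e.traceZero K := by
    simp only [mem_traceZero, map_zero, Finset.sum_const_zero]
  let z (a : K) : L := e.coprimeFun (ratX K L) (y + algebraMap K L a)
  have heval : e.coprimeFun (ratX K L) y = z 0 := by simp only [z, map_zero, add_zero]
  rw [← eval_map_algebraMap, ← derivative_map, hy.map_minpoly_coprimeFun hK hx, heval,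
    Lagrange.eval_nodal_derivative_eval_node_eq (v := z) h0, Lagrange.eval_nodal, map_prod,
    Finset.prod_congr rfl fun a ha ↦ hy.valuation_coprimeFun_add_sub hK hx h0
      (Finset.mem_of_mem_erase ha) (Finset.ne_of_mem_erase ha).symm,
    Finset.prod_const, Finset.card_erase_of_mem h0, card_traceZero hK, ← exp_nsmul, nsmul_eq_mul,
    Nat.cast_mul]

/-- Otherwise the trace of `f` would be a polynomial in `x` of degree `-1`. -/
theorem valuation_ne [Algebra K[X] L] [IsScalarTower K[X] (RatFunc K) L] [IsScalarTower K K[X] L]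
    {f : L} (hf : ∀ Q : Place K L, Q ≠ P → Q.v f ≤ 1) :
    P.v f ≠ exp ((e.q : ℤ) ^ (e.n + e.r - 1) - e.q ^ e.r - 1) := by
  intro hval
  have := hy.finiteDimensional
  have := hy.isSeparable
  have hintegral : IsIntegral K[X] f := isIntegral_of_forall_place fun Q hQ ↦ hf Q <| by
    rintro rfl
    exact hx.not_ge hQ
  have hnonneg := zero_le_intDegree_trace hintegral
  have hneg := (hy.isTotallyRamified P hx).intDegree_trace_eq_neg_one
    (hy.valuation_derivative_minpoly_coprimeFun hK hx) (f := f) <| by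
      have h1 : 1 ≤ e.q ^ (e.n - 1) := Nat.pow_pos e.q_pos
      have h2 : e.q ^ e.n ≤ e.q ^ (2 * e.r) :=
        Nat.pow_le_pow_right e.q_pos (by have := e.n_eq; have := e.m_le; omega)
      have h3 : e.n + e.r - 1 = (e.n - 1) + e.r := by have := e.n_pos; omega
      rw [hval, exp_inj, coprimeOrder]
      push_cast [Nat.cast_sub h1, Nat.cast_sub h2]
      rw [h3]
      ring
  omega

end IsCurveGenerator

end Exponents

namespace Place

variable {K F : Type*} [Field K] [Field F] [Algebra K F] (P : Place K F)

lemma poleOrder_eq (f : F) : P.poleOrder f = (log (P.v f)).toNat := by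
  rw [poleOrder, ord, neg_neg]

lemma poleOrder_eq_zero_iff {f : F} (hf : f ≠ 0) : P.poleOrder f = 0 ↔ P.v f ≤ 1 := by
  rw [poleOrder_eq, Int.toNat_eq_zero, log_le_iff_le_exp (P.v.ne_zero_iff.2 hf), exp_zero]

lemma poleOrder_eq_of_valuation_eq {f : F} {a : ℕ} (hf : P.v f = exp (a : ℤ)) :
    P.poleOrder f = a := by
  rw [poleOrder_eq, hf, log_exp, Int.toNat_natCast]

lemma valuation_eq_of_poleOrder_eq {f : F} {a : ℕ} (ha : 0 < a) (hf : P.poleOrder f = a) :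
    P.v f = exp (a : ℤ) := by
  rw [poleOrder_eq] at hf
  have hlog : log (P.v f) = a := by omega
  have hne : P.v f ≠ 0 := by
    intro h
    rw [h, log_zero] at hlog
    omega
  rw [← exp_log hne, hlog]

lemma mem_weierstrassSemigroup {f : F} {a : ℕ} (hf : P.v f = exp (a : ℤ))
    (hreg : ∀ Q : Place K F, Q ≠ P → Q.v f ≤ 1) : a ∈ P.weierstrassSemigroup := by
  have hf0 : f ≠ 0 := by
    rw [← P.v.ne_zero_iff, hf]
    exact exp_ne_zero
  exact ⟨f, hf0, P.poleOrder_eq_of_valuation_eq hf,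
    fun Q hQ ↦ (Q.poleOrder_eq_zero_iff hf0).2 (hreg Q hQ)⟩

lemma exists_of_mem_weierstrassSemigroup {a : ℕ} (ha : 0 < a) (h : a ∈ P.weierstrassSemigroup) :
    ∃ f : F, P.v f = exp (a : ℤ) ∧ ∀ Q : Place K F, Q ≠ P → Q.v f ≤ 1 := by
  obtain ⟨f, hf0, hf, hreg⟩ := h
  exact ⟨f, P.valuation_eq_of_poleOrder_eq ha hf,
    fun Q hQ ↦ (Q.poleOrder_eq_zero_iff hf0).1 (hreg Q hQ)⟩

/-- The Weierstrass semigroup `H(P)` as a submonoid of `ℕ`. -/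
def weierstrassSubmonoid : AddSubmonoid ℕ where
  carrier := P.weierstrassSemigroup
  zero_mem' := P.mem_weierstrassSemigroup (f := 1) (by rw [map_one, Nat.cast_zero, exp_zero])
    fun Q _ ↦ (map_one Q.v).le
  add_mem' := by
    intro a b ha hb
    rcases a.eq_zero_or_pos with rfl | ha0
    · rwa [zero_add]
    rcases b.eq_zero_or_pos with rfl | hb0
    · rwa [add_zero]
    obtain ⟨f, hf, hfreg⟩ := P.exists_of_mem_weierstrassSemigroup ha0 ha
    obtain ⟨g, hg, hgreg⟩ := P.exists_of_mem_weierstrassSemigroup hb0 hb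
    refine P.mem_weierstrassSemigroup (f := f * g) ?_ fun Q hQ ↦ ?_
    · rw [map_mul, hf, hg, ← exp_add, Nat.cast_add]
    · rw [map_mul]
      exact mul_le_one' (hfreg Q hQ) (hgreg Q hQ)

end Place

namespace Exponents

section Generators

variable (e : Exponents)

/-- The generators of the Weierstrass semigroup at infinity. -/
def generators : Set ℕ :=
  {e.q ^ (e.n - 1), e.q ^ (e.n - 1) + e.q ^ (e.r - 1), e.q ^ e.n + e.q ^ (e.n - e.r),
    e.q ^ (2 * e.r - 1) + e.q ^ (e.n - e.r - 1), e.q ^ (2 * e.r) - e.q ^ e.n + e.q ^ e.r + 1}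

/-- The largest gap of the semigroup generated by `generators`. -/
def frobeniusNumber : ℕ := e.q ^ (e.n + e.r - 1) - e.q ^ e.r - 1

lemma pow_r_add_one_lt : e.q ^ e.r + 1 < e.q ^ (e.n + e.r - 1) := by
  have h : 2 * e.q ^ e.r ≤ e.q ^ (e.n + e.r - 1) := two_mul_pow_le e.two_le_q (by
    have := e.n_eq
    have := e.m_pos
    have := e.r_pos
    omega)
  have := Nat.one_lt_pow e.r_pos.ne' e.two_le_q
  omega

lemma frobeniusNumber_pos : 0 < e.frobeniusNumber := by
  have := e.pow_r_add_one_lt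
  rw [frobeniusNumber]
  omega

lemma cast_frobeniusNumber :
    (e.frobeniusNumber : ℤ) = (e.q : ℤ) ^ (e.n + e.r - 1) - e.q ^ e.r - 1 := by
  have := e.pow_r_add_one_lt
  rw [frobeniusNumber, Nat.cast_sub (by omega), Nat.cast_sub (by omega)]
  push_cast
  rfl

variable {e}

lemma generators_eq_range {μ σ : ℕ} (hm : e.m = μ + 1) (hr : e.r = μ + σ + 2) :
    e.generators = Set.range (semigroupGenerators e.q μ σ) := by
  have hn : e.n = 2 * μ + σ + 3 := by have := e.n_eq; omega
  rw [range_semigroupGenerators, generators, hn, hr, Nat.add_one_sub_one, Nat.add_one_sub_one,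
    show 2 * μ + σ + 3 - (μ + σ + 2) = μ + 1 by omega, Nat.add_one_sub_one,
    show 2 * (μ + σ + 2) = 2 * μ + 2 * σ + 4 by omega, Nat.add_one_sub_one]

lemma closure_generators_of_eq (hmr : e.m = e.r) :
    AddSubmonoid.closure e.generators = AddSubmonoid.closure (Set.range ![e.q, e.q + 1]) := by
  have hr := e.r_eq_one_of_eq hmr
  have hn : e.n = 2 := by have := e.n_eq; omega
  have hgen : e.generators = {e.q, e.q + 1, (e.q + 1) * e.q, e.q + 1, e.q + 1} := by
    simp only [generators, hn, hr, add_mul, sq, Nat.add_one_sub_one, mul_one, Nat.sub_self, pow_one,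
      pow_zero, zero_add, one_mul]
  have hrange : Set.range ![e.q, e.q + 1] = {e.q, e.q + 1} := by
    simp only [Matrix.range_cons, Matrix.range_empty, Set.union_empty, Set.singleton_union]
  rw [hgen, hrange]
  refine le_antisymm (AddSubmonoid.closure_le.2 ?_) (AddSubmonoid.closure_mono (by grind))
  have hq : e.q ∈ AddSubmonoid.closure {e.q, e.q + 1} := AddSubmonoid.subset_closure (by simp)
  have hq1 : e.q + 1 ∈ AddSubmonoid.closure {e.q, e.q + 1} := AddSubmonoid.subset_closure (by simp)
  rintro _ (rfl | rfl | rfl | rfl | rfl)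
  exacts [hq, hq1, nsmul_mem hq (e.q + 1), hq1, hq1]

variable (e)

theorem exists_isTelescopicSeq_generators : ∃ (l : ℕ) (a : Fin (l + 1) → ℕ), IsTelescopicSeq a ∧
    AddSubmonoid.closure e.generators = AddSubmonoid.closure (Set.range a) ∧
    telescopicFrobenius a = e.frobeniusNumber := by
  have hn := e.n_eq
  rw [cast_frobeniusNumber]
  rcases e.m_le.lt_or_eq with hmr | hmr
  · obtain ⟨μ, hμ⟩ := Nat.exists_eq_add_of_lt e.m_pos
    obtain ⟨σ, hσ⟩ := Nat.exists_eq_add_of_lt hmr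
    refine ⟨4, _, isTelescopicSeq_semigroupGenerators e.q μ σ e.q_pos,
      congrArg AddSubmonoid.closure (generators_eq_range (by omega) (by omega)), ?_⟩
    rw [telescopicFrobenius_semigroupGenerators e.q μ σ e.q_pos,
      show 3 * μ + 2 * σ + 4 = e.n + e.r - 1 by omega, show μ + σ + 2 = e.r by omega]
  · refine ⟨1, _, isTelescopicSeq_self_succ e.q_pos, closure_generators_of_eq hmr, ?_⟩
    have hr := e.r_eq_one_of_eq hmr
    rw [telescopicFrobenius_self_succ, show e.n + e.r - 1 = 2 by omega, hr, pow_one]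

lemma isTelescopic_closure_generators :
    IsTelescopic (AddSubmonoid.closure e.generators : Set ℕ) := by
  obtain ⟨l, a, ha, hclosure, -⟩ := e.exists_isTelescopicSeq_generators
  exact ⟨l + 1, a, ha, congrArg SetLike.coe hclosure⟩

lemma isSymmetricAbout_closure_generators :
    IsSymmetricAbout (AddSubmonoid.closure e.generators) e.frobeniusNumber := by
  obtain ⟨l, a, ha, hclosure, hl⟩ := e.exists_isTelescopicSeq_generators
  rw [hclosure, ← hl]
  exact ha.isSymmetricAbout

end Generators

namespace IsCurveGenerator

variable {e : Exponents} {K L : Type*} [Field K] [Field L] [Algebra K L] [Algebra (RatFunc K) L]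
  [IsScalarTower K (RatFunc K) L] [ExpChar K e.p] [ExpChar L e.p] {y : L}
  (hy : e.IsCurveGenerator K y)

local notation "φ" => Exponents.frob e

include hy

lemma valuation_le_one {Q : Place K L} (hQ : Q.v (ratX K L) ≤ 1) : Q.v y ≤ 1 := by
  by_contra! h
  have hfrob (i : ℕ) : φ i (ratX K L) ∈ Q.v.integer := frob_mem hQ i
  have hle : Q.v (φ e.n y - y) ≤ 1 := by
    rw [hy.frobeniusEquation]
    exact mul_mem (sub_mem (hfrob _) hQ) (add_mem (hfrob _) (hfrob _))
  rw [valuation_frob_sub_self h e.n_pos] at hle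
  exact hle.not_gt (one_lt_pow₀ h (Nat.pow_pos e.q_pos).ne')

lemma valuation_ratX_lt_and_one_lt_iff {Q : Place K L} :
    Q.v (ratX K L) < Q.v y ∧ 1 < Q.v y ↔ 1 < Q.v (ratX K L) := by
  refine ⟨fun h ↦ lt_of_not_ge fun hx ↦ h.2.not_ge (hy.valuation_le_one hx), fun hx ↦ ?_⟩
  have hlt : Q.v (ratX K L) < Q.v y := by
    rw [← pow_lt_pow_iff_left₀ zero_le zero_le (Nat.pow_pos (n := e.n) e.q_pos).ne',
      hy.frobeniusEquation.valuation_y_pow hx]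
    exact pow_lt_pow_right₀ hx (Nat.lt_add_of_pos_right (Nat.pow_pos e.q_pos))
  exact ⟨hlt, hx.trans hlt⟩

variable {P : Place K L} (hx : 1 < P.v (ratX K L))

include hx

lemma valuation_eq_exp {w : L} {c : ℕ}
    (hw : P.v w ^ e.q ^ e.n = P.v (ratX K L) ^ (e.q * c)) : P.v w = exp (c : ℤ) := by
  have hpow := valuation_pow_pred_of_pow hw
  rw [(hy.isTotallyRamified P hx).valuation_ratX, ← exp_nsmul] at hpow
  rw [← pow_left_inj₀ zero_le zero_le (Nat.pow_pos (n := e.n - 1) e.q_pos).ne', hpow, ← exp_nsmul,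
    nsmul_eq_mul, nsmul_eq_mul, mul_comm]

lemma valuation_y : P.v y = exp ((e.q ^ (e.n - 1) + e.q ^ (e.r - 1) : ℕ) : ℤ) := by
  refine hy.valuation_eq_exp hx ?_
  rw [hy.frobeniusEquation.valuation_y_pow hx, mul_add, ← pow_succ', ← pow_succ',
    Nat.sub_add_cancel e.n_pos, Nat.sub_add_cancel e.r_pos]

lemma valuation_uFun :
    P.v (e.uFun (ratX K L) y) = exp ((e.q ^ e.n + e.q ^ (e.n - e.r) : ℕ) : ℤ) := by
  refine hy.valuation_eq_exp hx ?_
  rw [hy.frobeniusEquation.valuation_uFun_pow hx, add_comm, e.n_eq, Nat.add_sub_cancel_left]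

lemma valuation_wFun (hmr : e.m < e.r) : P.v (e.wFun (ratX K L) y) =
    exp ((e.q ^ (2 * e.r - 1) + e.q ^ (e.n - e.r - 1) : ℕ) : ℤ) := by
  refine hy.valuation_eq_exp hx ?_
  rw [hy.frobeniusEquation.valuation_wFun_pow hx hmr, mul_add, ← pow_succ', ← pow_succ', e.n_eq,
    Nat.add_sub_cancel_left, Nat.sub_add_cancel e.m_pos,
    Nat.sub_add_cancel (by have := e.r_pos; omega)]

variable (hreg : ∀ Q : Place K L, Q ≠ P → Q.v (ratX K L) ≤ 1)

include hreg

theorem generators_subset : e.generators ⊆ P.weierstrassSubmonoid := by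
  have hyreg (Q : Place K L) (hQ : Q ≠ P) : Q.v y ≤ 1 := hy.valuation_le_one (hreg Q hQ)
  have hymem := P.mem_weierstrassSemigroup (hy.valuation_y hx) hyreg
  rintro _ (rfl | rfl | rfl | rfl | rfl)
  · exact P.mem_weierstrassSemigroup (hy.isTotallyRamified P hx).valuation_ratX hreg
  · exact hymem
  · exact P.mem_weierstrassSemigroup (hy.valuation_uFun hx) fun Q hQ ↦
      uFun_mem (S := Q.v.integer) (hreg Q hQ) (hyreg Q hQ)
  · rcases e.m_le.lt_or_eq with hmr | hmr
    · exact P.mem_weierstrassSemigroup (hy.valuation_wFun hx hmr) fun Q hQ ↦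
        wFun_mem (S := Q.v.integer) (hreg Q hQ) (hyreg Q hQ)
    · have hr := e.r_eq_one_of_eq hmr
      have hn := e.n_eq
      rwa [show 2 * e.r - 1 = e.n - 1 by omega, show e.n - e.r - 1 = e.r - 1 by omega]
  · exact P.mem_weierstrassSemigroup (hy.isTotallyRamified P hx).valuation_gen fun Q hQ ↦
      coprimeFun_mem (S := Q.v.integer) (hreg Q hQ) (hyreg Q hQ)

theorem weierstrassSubmonoid_eq [Finite K] (hK : Nat.card K = e.q ^ e.n) [Algebra K[X] L]
    [IsScalarTower K[X] (RatFunc K) L] [IsScalarTower K K[X] L] :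
    P.weierstrassSubmonoid = AddSubmonoid.closure e.generators := by
  refine e.isSymmetricAbout_closure_generators.eq_of_le
    (AddSubmonoid.closure_le.2 (hy.generators_subset hx hreg)) fun hmem ↦ ?_
  obtain ⟨f, hf, hfreg⟩ := P.exists_of_mem_weierstrassSemigroup e.frobeniusNumber_pos hmem
  exact hy.valuation_ne hK hx hfreg (by rw [hf, cast_frobeniusNumber])

end IsCurveGenerator

end Exponents

section FunctionField

variable {K : Type*} [Field K] {q n r : ℕ}

lemma faithfulSMul_functionField (hq : 2 ≤ q) (hn : 0 < n) :
    FaithfulSMul K[X] (FunctionField K q n r) := by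
  rw [faithfulSMul_iff_algebraMap_injective,
    IsScalarTower.algebraMap_eq K[X] (CoordinateRing K q n r) (FunctionField K q n r),
    RingHom.coe_comp]
  refine (IsFractionRing.injective _ _).comp ((injective_iff_map_eq_zero _).2 fun g hg ↦ ?_)
  rw [AdjoinRoot.algebraMap_eq, ← AdjoinRoot.mk_C, AdjoinRoot.mk_eq_zero] at hg
  by_contra hg0
  refine (curvePoly_monic hq hn).not_dvd_of_natDegree_lt (C_ne_zero.2 hg0) ?_ hg
  rw [natDegree_C, natDegree_curvePoly hq hn]
  positivity

variable [IsDomain (CoordinateRing K q n r)] [Algebra (RatFunc K) (FunctionField K q n r)]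
  [IsScalarTower K[X] (RatFunc K) (FunctionField K q n r)]

lemma ratX_eq_xFun : ratX K (FunctionField K q n r) = xFun K q n r := by
  rw [ratX, ← RatFunc.algebraMap_X,
    ← IsScalarTower.algebraMap_apply K[X] (RatFunc K) (FunctionField K q n r),
    IsScalarTower.algebraMap_apply K[X] (CoordinateRing K q n r) (FunctionField K q n r),
    AdjoinRoot.algebraMap_eq, xFun]

lemma adjoin_yFun : IntermediateField.adjoin (RatFunc K) {yFun K q n r} = ⊤ := by
  have hmem (a : CoordinateRing K q n r) : algebraMap _ (FunctionField K q n r) a ∈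
      IntermediateField.adjoin (RatFunc K) {yFun K q n r} := by
    obtain ⟨g, rfl⟩ := AdjoinRoot.mk_surjective a
    rw [← AdjoinRoot.aeval_eq, ← aeval_algebraMap_apply, ← aeval_map_algebraMap (RatFunc K)]
    exact IntermediateField.algebra_adjoin_le_adjoin _ _
      (aeval_mem_adjoin_singleton (RatFunc K) (yFun K q n r))
  refine eq_top_iff.2 fun z _ ↦ ?_
  obtain ⟨a, b, -, rfl⟩ := IsFractionRing.div_surjective (A := CoordinateRing K q n r) z
  exact div_mem (hmem a) (hmem b)

end FunctionField

namespace Exponents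

variable (e : Exponents) (K : Type*) [Field K]

lemma expChar_of_card [Finite K] (hK : Nat.card K = e.q ^ e.n) : ExpChar K e.p := by
  have := Fintype.ofFinite K
  have : Fact e.p.Prime := ⟨e.prime⟩
  have : CharP K e.p := charP_of_card_eq_prime_pow (f := e.k * e.n) (by
    rw [← Nat.card_eq_fintype_card, hK, q, pow_mul])
  exact ExpChar.prime e.prime

theorem isCurveGenerator_yFun [IsDomain (CoordinateRing K e.q e.n e.r)]
    [Algebra (RatFunc K) (FunctionField K e.q e.n e.r)]
    [IsScalarTower K[X] (RatFunc K) (FunctionField K e.q e.n e.r)] :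
    e.IsCurveGenerator K (yFun K e.q e.n e.r) where
  aeval_eq_zero := by
    rw [curveRat, aeval_map_algebraMap, yFun, aeval_algebraMap_apply, AdjoinRoot.aeval_eq,
      AdjoinRoot.mk_self, map_zero]
  adjoin_eq_top := adjoin_yFun

end Exponents

end

end Xnr

theorem mainTheorem1 (K : Type*) [Field K] [Finite K] (q n r : ℕ) (hq : IsPrimePow q)
    (hK : Nat.card K = q ^ n) (hn : 2 ≤ n) (hr : n ≤ 2 * r) (hrn : r ≤ n - 1)
    (hnr : Nat.gcd n r = 1) (hodd : n = 2 → Odd q) :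
    ∃ _ : IsDomain (Xnr.CoordinateRing K q n r),
      ∃ P : Xnr.Place K (Xnr.FunctionField K q n r),
        (∀ Q : Xnr.Place K (Xnr.FunctionField K q n r),
          Xnr.LiesOverInfty K q n r Q ↔ Q = P) ∧
        P.weierstrassSemigroup =
          (AddSubmonoid.closure
            ({q ^ (n - 1), q ^ (n - 1) + q ^ (r - 1), q ^ n + q ^ (n - r),
              q ^ (2 * r - 1) + q ^ (n - r - 1), q ^ (2 * r) - q ^ n + q ^ r + 1} : Set ℕ) :
            Set ℕ) ∧
        Xnr.IsTelescopic P.weierstrassSemigroup ∧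
        Xnr.IsSymmetric P.weierstrassSemigroup := by
  obtain ⟨e, rfl, rfl, rfl⟩ := Xnr.Exponents.exists_eq hq hn hr hrn hnr hodd
  have := e.expChar_of_card K hK
  have := e.isDomain_coordinateRing K
  let F := Xnr.FunctionField K e.q e.n e.r
  have : ExpChar F e.p := expChar_of_injective_algebraMap (algebraMap K F).injective e.p
  have : FaithfulSMul K[X] F := Xnr.faithfulSMul_functionField e.two_le_q e.n_pos
  let := RatFunc.liftAlgebra K F
  have hy := e.isCurveGenerator_yFun K
  obtain ⟨P, hx, hunique⟩ := hy.existsUnique_place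
  have hsemigroup : P.weierstrassSemigroup = (AddSubmonoid.closure e.generators : Set ℕ) :=
    congrArg SetLike.coe <| hy.weierstrassSubmonoid_eq hx
      (fun Q hQ ↦ not_lt.1 fun h ↦ hQ (hunique Q h)) hK
  refine ⟨‹_›, P, fun Q ↦ ?_, hsemigroup, ?_, ?_⟩
  · rw [Xnr.LiesOverInfty, ← Xnr.ratX_eq_xFun, hy.valuation_ratX_lt_and_one_lt_iff]
    exact ⟨hunique Q, fun h ↦ h ▸ hx⟩
  · rw [hsemigroup]
    exact e.isTelescopic_closure_generators
  · rw [hsemigroup]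
    exact e.isSymmetricAbout_closure_generators.isSymmetric
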